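/- Let $K$ be a commutative ring with $1$. A Lie superalgebra over $K$ is a $\mathbb{Z}_2$-graded $K$-module $L=L_{\bar 0}\oplus L_{\bar 1}$ with an even bilinear bracket such that, for homogeneous $x,y$ and arbitrary $z$, $[x,y]=-(-1)^{|x||y|}[y,x]$ and $[x,[y,z]]=[[x,y],z]+(-1)^{|x||y|}[y,[x,z]]$, and moreover $[x,x]=0$ for $x\in L_{\bar 0}$ and $[x,[x,x]]=0$ for $x\in L_{\bar 1}$ (the last two conditions are automatic if $2$ and $3$ are invertible in $K$, e.g. if $K$ is a field of characteristic $0$). For a free presentation $0\to R\to F\to L\to 0$ of $L$, with $F$ the free Lie superalgebra on some $\mathbb{Z}_2$-graded set, and for $c\ge 1$, the $c$-nilpotent multiplier of $L$ is the abelian Lie superalgebra $$\mathcal{M}^{(c)}(L)=\frac{R\cap\gamma_{c+1}(F)}{\gamma_{c+1}(R,F)},$$ where $\gamma_1(R,F)=R$, $\gamma_{i+1}(R,F)=[\gamma_i(R,F),F]$ and $\gamma_i(F)=\gamma_i(F,F)$. Write $L^{ab}=L/[L,L]$. **Theorem.** Let $L_1$ and $L_2$ be two Lie superalgebras over $K$.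 Then, whichever free presentations are used to compute the three multipliers, there is an isomorphism of Lie superalgebras $$\mathcal{M}^{(2)}(L_1\oplus L_2)\cong \mathcal{M}^{(2)}(L_1)\oplus\mathcal{M}^{(2)}(L_2)\oplus (L_2^{ab}\otimes L_1^{ab}\otimes L_1^{ab})\oplus(L_2^{ab}\otimes L_1^{ab}\otimes L_2^{ab}),$$ where $\otimes=\otimes_K$ is the tensor product of $\mathbb{Z}_2$-graded modules, and the tensor products are regarded as abelian Lie superalgebras. -/

import Mathlib

open scoped TensorProduct

namespace LieSuper

noncomputable section

universe u v w

/-! ### Supermodules -/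

/-- A supermodule over `K`: a module with a direct sum decomposition into an even part `part 0`
and an odd part `part 1`. -/
class SuperModule (K : Type*) (V : Type*) [CommRing K] [AddCommGroup V] [Module K V] where
  part : ZMod 2 → Submodule K V
  isCompl : IsCompl (part 0) (part 1)

/-- The homogeneous component of degree `i`. -/
abbrev part (K : Type*) (V : Type*) [CommRing K] [AddCommGroup V] [Module K V] [SuperModule K V]
    (i : ZMod 2) : Submodule K V := SuperModule.part i

/-- The sign `(-1)^{ij}`. -/
def sign (K : Type*) [CommRing K] (i j : ZMod 2) : K := (-1) ^ (i.val * j.val)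

section SuperModule

variable {K : Type*} [CommRing K] {V W : Type*} [AddCommGroup V] [Module K V] [SuperModule K V]
  [AddCommGroup W] [Module K W] [SuperModule K W]

theorem exists_add (K : Type*) [CommRing K] {V : Type*} [AddCommGroup V] [Module K V]
    [SuperModule K V] (x : V) : ∃ a ∈ part K V 0, ∃ b ∈ part K V 1, a + b = x :=
  Submodule.mem_sup.1 ((SuperModule.isCompl (K := K) (V := V)).sup_eq_top ▸ Submodule.mem_top)

theorem eq_zero_of_mem {x : V} (h0 : x ∈ part K V 0) (h1 : x ∈ part K V 1) : x = 0 :=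
  Submodule.disjoint_def.1 (SuperModule.isCompl (K := K) (V := V)).disjoint x h0 h1

theorem add_unique {a b a' b' : V} (ha : a ∈ part K V 0) (hb : b ∈ part K V 1)
    (ha' : a' ∈ part K V 0) (hb' : b' ∈ part K V 1) (h : a + b = a' + b') :
    a = a' ∧ b = b' := by
  have h1 : a - a' = b' - b := by
    rw [sub_eq_sub_iff_add_eq_add, h, add_comm]
  have h2 : a - a' = 0 :=
    eq_zero_of_mem (K := K) (sub_mem ha ha') (h1 ▸ sub_mem hb' hb)
  exact ⟨sub_eq_zero.1 h2, (sub_eq_zero.1 (h1 ▸ h2)).symm⟩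

theorem super_induction (K : Type*) [CommRing K] {V : Type*} [AddCommGroup V] [Module K V]
    [SuperModule K V] {p : V → Prop} (x : V) (hadd : ∀ x y, p x → p y → p (x + y))
    (h : ∀ i, ∀ x ∈ part K V i, p x) : p x := by
  obtain ⟨a, ha, b, hb, rfl⟩ := exists_add K x
  exact hadd _ _ (h 0 a ha) (h 1 b hb)

/-- A submodule `N` is graded (homogeneous) if `N = (N ∩ V₀) + (N ∩ V₁)`. -/
def IsHomogeneous (N : Submodule K V) : Prop :=
  N ≤ (N ⊓ part K V 0) ⊔ (N ⊓ part K V 1)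

theorem IsHomogeneous.exists_add {N : Submodule K V} (hN : IsHomogeneous N) {x : V} (hx : x ∈ N) :
    ∃ a ∈ N, ∃ b ∈ N, a ∈ part K V 0 ∧ b ∈ part K V 1 ∧ a + b = x := by
  obtain ⟨a, ha, b, hb, h⟩ := Submodule.mem_sup.1 (hN hx)
  exact ⟨a, ha.1, b, hb.1, ha.2, hb.2, h⟩

theorem IsHomogeneous.inf {N M : Submodule K V} (hN : IsHomogeneous N) (hM : IsHomogeneous M) :
    IsHomogeneous (N ⊓ M) := by
  rintro x ⟨hx, hx'⟩
  obtain ⟨a, haN, b, hbN, ha, hb, rfl⟩ := hN.exists_add hx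
  obtain ⟨a', haM, b', hbM, ha', hb', h⟩ := hM.exists_add hx'
  obtain ⟨rfl, rfl⟩ := add_unique ha' hb' ha hb h
  exact Submodule.mem_sup.2 ⟨_, ⟨⟨haN, haM⟩, ha⟩, _, ⟨⟨hbN, hbM⟩, hb⟩, rfl⟩

/-- The induced grading on a graded submodule. -/
abbrev superSubmodule (N : Submodule K V) (hN : IsHomogeneous N) : SuperModule K N where
  part i := (part K V i).comap N.subtype
  isCompl := by
    refine ⟨Submodule.disjoint_def.2 ?_, codisjoint_iff.2 (eq_top_iff.2 ?_)⟩
    · intro x h0 h1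
      exact Subtype.ext (eq_zero_of_mem (K := K) h0 h1)
    · rintro ⟨x, hx⟩ -
      obtain ⟨a, haN, b, hbN, ha, hb, rfl⟩ := hN.exists_add hx
      exact Submodule.mem_sup.2 ⟨⟨a, haN⟩, ha, ⟨b, hbN⟩, hb, rfl⟩

/-- The induced grading on the quotient by a graded submodule. -/
abbrev superQuotient (N : Submodule K V) (hN : IsHomogeneous N) : SuperModule K (V ⧸ N) where
  part i := (part K V i).map N.mkQ
  isCompl := by
    refine ⟨Submodule.disjoint_def.2 ?_, codisjoint_iff.2 (eq_top_iff.2 ?_)⟩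
    · rintro _ ⟨a, ha, rfl⟩ ⟨b, hb, h⟩
      have h1 : a - b ∈ N := (Submodule.Quotient.eq N).1 h.symm
      obtain ⟨a', haN, b', hbN, ha', hb', h2⟩ := hN.exists_add h1
      have h3 : a' + b' = a + -b := by rw [h2, sub_eq_add_neg]
      obtain ⟨rfl, -⟩ := add_unique ha' hb' ha (neg_mem hb) h3
      exact (Submodule.Quotient.mk_eq_zero N).2 haN
    · intro x _
      obtain ⟨x, rfl⟩ := N.mkQ_surjective x
      obtain ⟨a, ha, b, hb, rfl⟩ := LieSuper.exists_add K x
      exact Submodule.mem_sup.2 ⟨_, ⟨a, ha, rfl⟩, _, ⟨b, hb, rfl⟩, (map_add _ _ _).symm⟩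

/-- The direct sum of two supermodules. -/
instance : SuperModule K (V × W) where
  part i := (part K V i).prod (part K W i)
  isCompl := by
    refine ⟨Submodule.disjoint_def.2 ?_, codisjoint_iff.2 (eq_top_iff.2 ?_)⟩
    · intro x h0 h1
      exact Prod.ext (eq_zero_of_mem (K := K) h0.1 h1.1) (eq_zero_of_mem (K := K) h0.2 h1.2)
    · rintro ⟨x, y⟩ -
      obtain ⟨a, ha, b, hb, rfl⟩ := LieSuper.exists_add K x
      obtain ⟨c, hc, d, hd, rfl⟩ := LieSuper.exists_add K y
      exact Submodule.mem_sup.2 ⟨(a, c), ⟨ha, hc⟩, (b, d), ⟨hb, hd⟩, rfl⟩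

/-- The tensor product of two supermodules, with `(V ⊗ W)_k = ∑_i V_i ⊗ W_{k-i}`. -/
instance : SuperModule K (V ⊗[K] W) where
  part k := ⨆ i : ZMod 2, Submodule.map₂ (TensorProduct.mk K V W) (part K V i) (part K W (k - i))
  isCompl := by
    have hV : IsCompl (part K V 0) (part K V 1) := SuperModule.isCompl
    have hW : IsCompl (part K W 0) (part K W 1) := SuperModule.isCompl
    let p := Submodule.projection _ _ hV
    let q := Submodule.projection _ _ hW
    have p0 : ∀ x ∈ part K V 0, p x = x := fun x hx =>
      Submodule.projection_apply_left hV ⟨x, hx⟩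
    have p1 : ∀ x ∈ part K V 1, p x = 0 := fun x hx =>
      Submodule.projection_apply_right hV ⟨x, hx⟩
    have q0 : ∀ x ∈ part K W 0, q x = x := fun x hx =>
      Submodule.projection_apply_left hW ⟨x, hx⟩
    have q1 : ∀ x ∈ part K W 1, q x = 0 := fun x hx =>
      Submodule.projection_apply_right hW ⟨x, hx⟩
    let P : V ⊗[K] W →ₗ[K] V ⊗[K] W :=
      TensorProduct.map p q + TensorProduct.map (LinearMap.id - p) (LinearMap.id - q)
    refine ⟨Submodule.disjoint_def.2 ?_, codisjoint_iff.2 (eq_top_iff.2 ?_)⟩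
    · intro x h0 h1
      have e0 : (⨆ i : ZMod 2, Submodule.map₂ (TensorProduct.mk K V W) (part K V i)
          (part K W (0 - i))) ≤ LinearMap.ker (P - LinearMap.id) := by
        refine iSup_le fun i => Submodule.map₂_le.2 fun a ha b hb => ?_
        fin_cases i
        · have hb' : b ∈ part K W 0 := hb
          simp [P, p0 a ha, q0 b hb']
        · have hb' : b ∈ part K W 1 := hb
          simp [P, p1 a ha, q1 b hb']
      have e1 : (⨆ i : ZMod 2, Submodule.map₂ (TensorProduct.mk K V W) (part K V i)
          (part K W (1 - i))) ≤ LinearMap.ker P := by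
        refine iSup_le fun i => Submodule.map₂_le.2 fun a ha b hb => ?_
        fin_cases i
        · have hb' : b ∈ part K W 1 := hb
          simp [P, p0 a ha, q1 b hb']
        · have hb' : b ∈ part K W 0 := hb
          simp [P, p1 a ha, q0 b hb']
      have h2 : P x - x = 0 := e0 h0
      rw [LinearMap.mem_ker.1 (e1 h1), zero_sub, neg_eq_zero] at h2
      exact h2
    · rw [← TensorProduct.map₂_mk_top_top_eq_top, Submodule.map₂_le]
      intro x _ y _
      have key : ∀ i j k : ZMod 2, k - i = j → ∀ a ∈ part K V i, ∀ b ∈ part K W j,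
          TensorProduct.mk K V W a b ∈ ⨆ i : ZMod 2, Submodule.map₂ (TensorProduct.mk K V W)
            (part K V i) (part K W (k - i)) := fun i j k hk a ha b hb =>
        Submodule.mem_iSup_of_mem i (Submodule.apply_mem_map₂ _ ha (hk ▸ hb))
      obtain ⟨S, hS⟩ : ∃ S, S = (⨆ i : ZMod 2, Submodule.map₂ (TensorProduct.mk K V W)
          (part K V i) (part K W (0 - i))) ⊔ ⨆ i : ZMod 2, Submodule.map₂ (TensorProduct.mk K V W)
          (part K V i) (part K W (1 - i)) := ⟨_, rfl⟩
      rw [← hS]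
      refine super_induction K (p := fun x => TensorProduct.mk K V W x y ∈ S) x
        (fun x x' h h' => ?_) fun i a ha =>
        super_induction K (p := fun y => TensorProduct.mk K V W a y ∈ S) y
        (fun y y' h h' => ?_) fun j b hb => ?_
      · rw [map_add, LinearMap.add_apply]; exact add_mem h h'
      · rw [map_add]; exact add_mem h h'
      · subst hS
        obtain h | h : i + j = 0 ∨ i + j = 1 := by clear * -; revert i j; decide
        · exact Submodule.mem_sup_left
            (key i j 0 (by rw [← h, add_sub_cancel_left]) a ha b hb)
        · exact Submodule.mem_sup_right
            (key i j 1 (by rw [← h, add_sub_cancel_left]) a ha b hb)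

end SuperModule

/-! ### Lie superalgebras -/

/-- A Lie superalgebra over a commutative ring `K`: a supermodule with an even bilinear bracket
that is super skew-symmetric and satisfies the super Jacobi identity. The last two axioms follow
from the others when `2` and `3` are invertible in `K`. -/
class LieSuperalgebra (K : Type*) (L : Type*) [CommRing K] [AddCommGroup L] [Module K L] extends
    SuperModule K L where
  bracket : L →ₗ[K] L →ₗ[K] L
  bracket_mem : ∀ i j : ZMod 2, ∀ x ∈ part i, ∀ y ∈ part j, bracket x y ∈ part (i + j)
  skew : ∀ i j : ZMod 2, ∀ x ∈ part i, ∀ y ∈ part j,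
    bracket x y = -(sign K i j • bracket y x)
  jacobi : ∀ i j : ZMod 2, ∀ x ∈ part i, ∀ y ∈ part j, ∀ z,
    bracket x (bracket y z) = bracket (bracket x y) z + sign K i j • bracket y (bracket x z)
  even_self : ∀ x ∈ part 0, bracket x x = 0
  odd_self : ∀ x ∈ part 1, bracket x (bracket x x) = 0

/-- The bracket `[x, y]` of a Lie superalgebra over `K`. -/
abbrev br (K : Type*) {L : Type*} [CommRing K] [AddCommGroup L] [Module K L] [LieSuperalgebra K L]
    (x y : L) : L := LieSuperalgebra.bracket (K := K) x y

/-- A homomorphism of Lie superalgebras: an even linear map preserving the bracket. -/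
structure LieSuperHom (K : Type*) (L L' : Type*) [CommRing K] [AddCommGroup L] [Module K L]
    [LieSuperalgebra K L] [AddCommGroup L'] [Module K L'] [LieSuperalgebra K L'] extends
    L →ₗ[K] L' where
  map_part : ∀ i, ∀ x ∈ part K L i, toFun x ∈ part K L' i
  map_br : ∀ x y, toFun (br K x y) = br K (toFun x) (toFun y)

/-- An isomorphism of Lie superalgebras: an even linear equivalence preserving the bracket. -/
structure LieSuperEquiv (K : Type*) (L L' : Type*) [CommRing K] [AddCommGroup L] [Module K L]
    [LieSuperalgebra K L] [AddCommGroup L'] [Module K L'] [LieSuperalgebra K L'] extends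
    L ≃ₗ[K] L' where
  map_part : ∀ i, ∀ x ∈ part K L i, toFun x ∈ part K L' i
  map_br : ∀ x y, toFun (br K x y) = br K (toFun x) (toFun y)

/-- The direct sum of two Lie superalgebras. -/
instance {K : Type*} [CommRing K] {L L' : Type*} [AddCommGroup L] [Module K L]
    [LieSuperalgebra K L] [AddCommGroup L'] [Module K L'] [LieSuperalgebra K L'] :
    LieSuperalgebra K (L × L') where
  toSuperModule := inferInstance
  bracket := LinearMap.mk₂ K (fun x y => (br K x.1 y.1, br K x.2 y.2))
    (fun _ _ _ => by simp [br]) (fun _ _ _ => by simp [br])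
    (fun _ _ _ => by simp [br]) (fun _ _ _ => by simp [br])
  bracket_mem i j x hx y hy := ⟨LieSuperalgebra.bracket_mem i j _ hx.1 _ hy.1,
    LieSuperalgebra.bracket_mem i j _ hx.2 _ hy.2⟩
  skew i j x hx y hy := Prod.ext (LieSuperalgebra.skew i j _ hx.1 _ hy.1)
    (LieSuperalgebra.skew i j _ hx.2 _ hy.2)
  jacobi i j x hx y hy z := Prod.ext (LieSuperalgebra.jacobi i j _ hx.1 _ hy.1 _)
    (LieSuperalgebra.jacobi i j _ hx.2 _ hy.2 _)
  even_self x hx := Prod.ext (LieSuperalgebra.even_self _ hx.1) (LieSuperalgebra.even_self _ hx.2)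
  odd_self x hx := Prod.ext (LieSuperalgebra.odd_self _ hx.1) (LieSuperalgebra.odd_self _ hx.2)

/-- The supermodule `V`, regarded as an abelian Lie superalgebra. -/
def AbelianLie (V : Type*) : Type _ := V

section AbelianLie

variable {V : Type*} [AddCommGroup V]

instance : AddCommGroup (AbelianLie V) := inferInstanceAs (AddCommGroup V)

instance {K : Type*} [CommRing K] [Module K V] : Module K (AbelianLie V) :=
  inferInstanceAs (Module K V)

instance {K : Type*} [CommRing K] [Module K V] [SuperModule K V] :
    LieSuperalgebra K (AbelianLie V) where
  toSuperModule := inferInstanceAs (SuperModule K V)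
  bracket := 0
  bracket_mem _ _ _ _ _ _ := zero_mem _
  skew _ _ _ _ _ _ := by simp
  jacobi _ _ _ _ _ _ _ := by simp
  even_self _ _ := rfl
  odd_self _ _ := rfl

end AbelianLie

/-! ### Graded ideals, quotients, the lower central series -/

/-- A graded ideal of a Lie superalgebra. -/
structure SuperIdeal (K : Type*) (L : Type*) [CommRing K] [AddCommGroup L] [Module K L]
    [LieSuperalgebra K L] where
  carrier : Submodule K L
  homogeneous : IsHomogeneous carrier
  br_mem : ∀ x, ∀ y ∈ carrier, br K x y ∈ carrier

namespace SuperIdeal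

variable {K : Type*} [CommRing K] {L : Type*} [AddCommGroup L] [Module K L] [LieSuperalgebra K L]

theorem br_mem_right (I : SuperIdeal K L) {x : L} (hx : x ∈ I.carrier) (y : L) :
    br K x y ∈ I.carrier := by
  obtain ⟨a, haI, b, hbI, ha, hb, rfl⟩ := I.homogeneous.exists_add hx
  have key : ∀ i, ∀ a ∈ I.carrier, a ∈ part K L i → br K a y ∈ I.carrier := by
    intro i a haI ha
    refine super_induction K (p := fun y => br K a y ∈ I.carrier) y (fun y y' h h' => ?_)
      fun j y hy => ?_
    · rw [br, map_add]; exact add_mem h h'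
    · rw [br, LieSuperalgebra.skew i j a ha y hy]
      exact neg_mem (Submodule.smul_mem _ _ (I.br_mem y a haI))
  rw [br, map_add, LinearMap.add_apply]
  exact add_mem (key 0 a haI ha) (key 1 b hbI hb)

/-- The whole Lie superalgebra. -/
def top (K : Type*) [CommRing K] (L : Type*) [AddCommGroup L] [Module K L]
    [LieSuperalgebra K L] : SuperIdeal K L where
  carrier := ⊤
  homogeneous x _ := by
    obtain ⟨a, ha, b, hb, rfl⟩ := exists_add K x
    exact Submodule.mem_sup.2 ⟨a, ⟨trivial, ha⟩, b, ⟨trivial, hb⟩, rfl⟩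
  br_mem _ _ _ := trivial

/-- The intersection of two graded ideals. -/
def inf (I J : SuperIdeal K L) : SuperIdeal K L where
  carrier := I.carrier ⊓ J.carrier
  homogeneous := I.homogeneous.inf J.homogeneous
  br_mem x y hy := ⟨I.br_mem x y hy.1, J.br_mem x y hy.2⟩

/-- The ideal `[I, J]`, spanned by all brackets `[x, y]` with `x ∈ I` and `y ∈ J`. -/
def comm (I J : SuperIdeal K L) : SuperIdeal K L where
  carrier := Submodule.span K {z | ∃ x ∈ I.carrier, ∃ y ∈ J.carrier, br K x y = z}
  homogeneous := by
    have key : ∀ i j, ∀ x ∈ I.carrier, x ∈ part K L i → ∀ y ∈ J.carrier, y ∈ part K L j →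
        br K x y ∈ (Submodule.span K {z | ∃ x ∈ I.carrier, ∃ y ∈ J.carrier, br K x y = z} ⊓
          part K L 0) ⊔ (Submodule.span K {z | ∃ x ∈ I.carrier, ∃ y ∈ J.carrier, br K x y = z} ⊓
          part K L 1) := by
      intro i j x hxI hx y hyJ hy
      have h := LieSuperalgebra.bracket_mem i j x hx y hy
      have h' := Submodule.subset_span (R := K)
        (s := {z | ∃ x ∈ I.carrier, ∃ y ∈ J.carrier, br K x y = z}) ⟨x, hxI, y, hyJ, rfl⟩
      obtain e | e : i + j = 0 ∨ i + j = 1 := by clear * -; revert i j; decide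
      · exact Submodule.mem_sup_left ⟨h', e ▸ h⟩
      · exact Submodule.mem_sup_right ⟨h', e ▸ h⟩
    refine Submodule.span_le.2 ?_
    rintro _ ⟨x, hx, y, hy, rfl⟩
    obtain ⟨a, haI, b, hbI, ha, hb, rfl⟩ := I.homogeneous.exists_add hx
    obtain ⟨c, hcJ, d, hdJ, hc, hd, rfl⟩ := J.homogeneous.exists_add hy
    simp only [br, map_add, LinearMap.add_apply]
    exact add_mem (add_mem (key _ _ a haI ha c hcJ hc) (key _ _ b hbI hb c hcJ hc))
      (add_mem (key _ _ a haI ha d hdJ hd) (key _ _ b hbI hb d hdJ hd))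
  br_mem z w hw := by
    refine Submodule.span_induction (fun w hw => ?_) (by simp [br])
      (fun u v _ _ hu hv => ?_) (fun r u _ hu => ?_) hw
    · obtain ⟨x, hx, y, hy, rfl⟩ := hw
      obtain ⟨a, haI, b, hbI, ha, hb, rfl⟩ := I.homogeneous.exists_add hx
      have key : ∀ i, ∀ x ∈ I.carrier, x ∈ part K L i → br K z (br K x y) ∈
          Submodule.span K {z | ∃ x ∈ I.carrier, ∃ y ∈ J.carrier, br K x y = z} := by
        intro i x hxI hx
        refine super_induction K (p := fun z => br K z (br K x y) ∈
          Submodule.span K {z | ∃ x ∈ I.carrier, ∃ y ∈ J.carrier, br K x y = z}) z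
          (fun z z' h h' => ?_) fun j z hz => ?_
        · rw [br, map_add]; exact add_mem h h'
        · rw [br, br, LieSuperalgebra.jacobi j i z hz x hx y]
          exact add_mem (Submodule.subset_span ⟨_, I.br_mem z x hxI, y, hy, rfl⟩)
            (Submodule.smul_mem _ _ (Submodule.subset_span ⟨x, hxI, _, J.br_mem z y hy, rfl⟩))
      have e : br K z (br K (a + b) y) = br K z (br K a y) + br K z (br K b y) := by simp [br]
      rw [e]
      exact add_mem (key 0 a haI ha) (key 1 b hbI hb)
    · rw [br, map_add]; exact add_mem hu hv
    · rw [br, map_smul]; exact Submodule.smul_mem _ _ hu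

/-- The series `γ₁(I, L) = I`, `γ_{n+1}(I, L) = [γ_n(I, L), L]`; here `I.gamma n` is
`γ_{n+1}(I, L)`. -/
def gamma (I : SuperIdeal K L) : ℕ → SuperIdeal K L
  | 0 => I
  | n + 1 => (I.gamma n).comm (top K L)

/-- A graded ideal, as a Lie superalgebra. -/
def Sub (I : SuperIdeal K L) : Type _ := I.carrier

/-- The quotient of a Lie superalgebra by a graded ideal. -/
def Quotient (I : SuperIdeal K L) : Type _ := L ⧸ I.carrier

instance (I : SuperIdeal K L) : AddCommGroup I.Sub := inferInstanceAs (AddCommGroup I.carrier)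

instance (I : SuperIdeal K L) : Module K I.Sub := inferInstanceAs (Module K I.carrier)

instance (I : SuperIdeal K L) : AddCommGroup I.Quotient :=
  inferInstanceAs (AddCommGroup (L ⧸ I.carrier))

instance (I : SuperIdeal K L) : Module K I.Quotient := inferInstanceAs (Module K (L ⧸ I.carrier))

/-- The inclusion of a graded ideal. -/
def incl (I : SuperIdeal K L) : I.Sub →ₗ[K] L := I.carrier.subtype

/-- The quotient map. -/
def proj (I : SuperIdeal K L) : L →ₗ[K] I.Quotient := I.carrier.mkQ

theorem incl_injective (I : SuperIdeal K L) : Function.Injective I.incl :=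
  Subtype.val_injective

theorem proj_surjective (I : SuperIdeal K L) : Function.Surjective I.proj :=
  I.carrier.mkQ_surjective

instance (I : SuperIdeal K L) : LieSuperalgebra K I.Sub where
  toSuperModule := superSubmodule I.carrier I.homogeneous
  bracket := LinearMap.mk₂ K (fun x y : I.Sub => (⟨br K (I.incl x) (I.incl y),
      I.br_mem _ _ y.2⟩ : I.carrier))
    (fun x y z => I.incl_injective (by
      change br K (I.incl (x + y)) (I.incl z) = br K (I.incl x) (I.incl z) + br K (I.incl y) (I.incl z)
      simp [br]))
    (fun r x y => I.incl_injective (by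
      change br K (I.incl (r • x)) (I.incl y) = r • br K (I.incl x) (I.incl y)
      simp [br]))
    (fun x y z => I.incl_injective (by
      change br K (I.incl x) (I.incl (y + z)) = br K (I.incl x) (I.incl y) + br K (I.incl x) (I.incl z)
      simp [br]))
    (fun r x y => I.incl_injective (by
      change br K (I.incl x) (I.incl (r • y)) = r • br K (I.incl x) (I.incl y)
      simp [br]))
  bracket_mem i j x hx y hy := LieSuperalgebra.bracket_mem i j (I.incl x) hx (I.incl y) hy
  skew i j x hx y hy := I.incl_injective (LieSuperalgebra.skew i j (I.incl x) hx (I.incl y) hy)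
  jacobi i j x hx y hy z :=
    I.incl_injective (LieSuperalgebra.jacobi i j (I.incl x) hx (I.incl y) hy (I.incl z))
  even_self x hx := I.incl_injective (LieSuperalgebra.even_self (I.incl x) hx)
  odd_self x hx := I.incl_injective (LieSuperalgebra.odd_self (I.incl x) hx)

instance (I : SuperIdeal K L) : LieSuperalgebra K I.Quotient where
  toSuperModule := superQuotient I.carrier I.homogeneous
  bracket := I.carrier.liftQ
    (LinearMap.flip (I.carrier.liftQ
      (LinearMap.flip ((LieSuperalgebra.bracket (K := K)).compr₂ I.proj))
      fun y hy => LinearMap.ext fun x =>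
        (Submodule.Quotient.mk_eq_zero I.carrier).2 (I.br_mem x y hy)))
    fun x hx => LinearMap.ext fun y => by
      obtain ⟨y, rfl⟩ := I.proj_surjective y
      exact (Submodule.Quotient.mk_eq_zero I.carrier).2 (I.br_mem_right hx y)
  bracket_mem := by
    rintro i j _ ⟨x, hx, rfl⟩ _ ⟨y, hy, rfl⟩
    exact ⟨_, LieSuperalgebra.bracket_mem i j x hx y hy, rfl⟩
  skew := by
    rintro i j _ ⟨x, hx, rfl⟩ _ ⟨y, hy, rfl⟩
    exact congrArg I.proj (LieSuperalgebra.skew i j x hx y hy)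
  jacobi := by
    rintro i j _ ⟨x, hx, rfl⟩ _ ⟨y, hy, rfl⟩ z
    obtain ⟨z, rfl⟩ := I.proj_surjective z
    exact congrArg I.proj (LieSuperalgebra.jacobi i j x hx y hy z)
  even_self := by
    rintro _ ⟨x, hx, rfl⟩
    exact congrArg I.proj (LieSuperalgebra.even_self x hx)
  odd_self := by
    rintro _ ⟨x, hx, rfl⟩
    exact congrArg I.proj (LieSuperalgebra.odd_self x hx)

/-- `I ∩ J`, as a graded ideal of `J`. -/
def restrict (I J : SuperIdeal K L) : SuperIdeal K J.Sub where
  carrier := I.carrier.comap J.incl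
  homogeneous x hx := by
    obtain ⟨a, ha, b, hb, rfl⟩ := exists_add K x
    have hx' : J.incl a + J.incl b ∈ I.carrier := by rw [← map_add]; exact hx
    obtain ⟨a', haI, b', hbI, ha', hb', h⟩ := I.homogeneous.exists_add hx'
    obtain ⟨rfl, rfl⟩ := add_unique (K := K) ha' hb' (show J.incl a ∈ part K L 0 from ha)
      (show J.incl b ∈ part K L 1 from hb) h
    exact Submodule.mem_sup.2 ⟨a, ⟨haI, ha⟩, b, ⟨hbI, hb⟩, rfl⟩
  br_mem x y hy := I.br_mem (J.incl x) (J.incl y) hy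

end SuperIdeal

/-- The kernel of a homomorphism of Lie superalgebras. -/
def LieSuperHom.ker {K : Type*} [CommRing K] {L L' : Type*} [AddCommGroup L] [Module K L]
    [LieSuperalgebra K L] [AddCommGroup L'] [Module K L'] [LieSuperalgebra K L']
    (f : LieSuperHom K L L') : SuperIdeal K L where
  carrier := LinearMap.ker f.toLinearMap
  homogeneous x hx := by
    obtain ⟨a, ha, b, hb, rfl⟩ := exists_add K x
    have h : f.toLinearMap a + f.toLinearMap b = 0 + 0 := by
      rw [← map_add, LinearMap.mem_ker.1 hx, add_zero]
    obtain ⟨h0, h1⟩ := add_unique (K := K) (show f.toLinearMap a ∈ part K L' 0 from f.map_part 0 a ha)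
      (f.map_part 1 b hb) (zero_mem _) (zero_mem _) h
    exact Submodule.mem_sup.2 ⟨a, ⟨h0, ha⟩, b, ⟨h1, hb⟩, rfl⟩
  br_mem x y hy := by
    have h : f.toLinearMap (br K x y) = br K (f.toLinearMap x) (f.toLinearMap y) := f.map_br x y
    rw [LinearMap.mem_ker, h, LinearMap.mem_ker.1 hy, br, map_zero]

/-- The abelianization `L^ab = L / [L, L]`. -/
abbrev Ab (K : Type*) [CommRing K] (L : Type*) [AddCommGroup L] [Module K L]
    [LieSuperalgebra K L] : Type _ :=
  ((SuperIdeal.top K L).comm (SuperIdeal.top K L)).Quotient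

/-! ### Free Lie superalgebras -/

section Free

variable (K : Type*) [CommRing K] {X : Type*} (deg : X → ZMod 2)

/-- The degree of a non-associative monomial in a `ℤ/2`-graded alphabet: the sum of the degrees
of its letters. -/
def monoDeg : FreeMagma X → ZMod 2
  | FreeMagma.of x => deg x
  | FreeMagma.mul u v => monoDeg u + monoDeg v

/-- The free non-associative algebra on a `ℤ/2`-graded set is graded: the component of degree `i`
is spanned by the monomials of degree `i`. -/
def freePart (i : ZMod 2) : Submodule K (FreeNonUnitalNonAssocAlgebra K X) :=
  Submodule.span K ((fun w => MonoidAlgebra.single w (1 : K)) '' {w | monoDeg deg w = i})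

/-- The free non-associative algebra on a `ℤ/2`-graded set, as a supermodule. -/
abbrev freeSuper : SuperModule K (FreeNonUnitalNonAssocAlgebra K X) where
  part := freePart K deg
  isCompl := by
    have h : IsCompl {w | monoDeg deg w = 0} {w | monoDeg deg w = 1} := by
      refine ⟨Set.disjoint_left.2 fun w h0 h1 => ?_, codisjoint_iff.2 (Set.eq_univ_of_forall
        fun w => ?_)⟩
      · exact zero_ne_one ((show monoDeg deg w = 0 from h0).symm.trans h1)
      · have : ∀ i : ZMod 2, i = 0 ∨ i = 1 := by decide
        exact this (monoDeg deg w)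
    have h' : IsCompl (Finsupp.supported K K {w | monoDeg deg w = 0})
        (Finsupp.supported K K {w | monoDeg deg w = 1}) :=
      ⟨Finsupp.disjoint_supported_supported h.1, Finsupp.codisjoint_supported_supported h.2⟩
    unfold freePart
    rw [← MonoidAlgebra.supported_eq_span_single, ← MonoidAlgebra.supported_eq_span_single,
      MonoidAlgebra.supported_eq_map, MonoidAlgebra.supported_eq_map]
    exact h'.map (Submodule.orderIsoMapComap (MonoidAlgebra.coeffLinearEquiv K).symm)

theorem freePart_mul {i j : ZMod 2} {x y : FreeNonUnitalNonAssocAlgebra K X}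
    (hx : x ∈ freePart K deg i) (hy : y ∈ freePart K deg j) : x * y ∈ freePart K deg (i + j) := by
  have h : Submodule.map₂ (LinearMap.mul K (FreeNonUnitalNonAssocAlgebra K X)) (freePart K deg i)
      (freePart K deg j) ≤ freePart K deg (i + j) := by
    unfold freePart
    rw [Submodule.map₂_span_span, Submodule.span_le]
    rintro _ ⟨_, ⟨u, hu, rfl⟩, _, ⟨v, hv, rfl⟩, rfl⟩
    refine Submodule.subset_span ⟨u * v, ?_, ?_⟩
    · change monoDeg deg u + monoDeg deg v = i + j
      rw [show monoDeg deg u = i from hu, show monoDeg deg v = j from hv]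
    · simp [MonoidAlgebra.single_mul_single]
  exact h (Submodule.apply_mem_map₂ _ hx hy)

/-- The defining relations of the free Lie superalgebra, `x`, `y` being homogeneous: super
skew-symmetry, the super Jacobi identity, `[x, x] = 0` for `x` even and `[x, [x, x]] = 0` for
`x` odd. -/
inductive FreeRel : FreeNonUnitalNonAssocAlgebra K X → Prop
  | skew (i j : ZMod 2) (x y : FreeNonUnitalNonAssocAlgebra K X) (hx : x ∈ freePart K deg i)
      (hy : y ∈ freePart K deg j) : FreeRel (x * y + sign K i j • (y * x))
  | jacobi (i j k : ZMod 2) (x y z : FreeNonUnitalNonAssocAlgebra K X) (hx : x ∈ freePart K deg i)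
      (hy : y ∈ freePart K deg j) (hz : z ∈ freePart K deg k) :
      FreeRel (x * (y * z) - (x * y) * z - sign K i j • (y * (x * z)))
  | even_self (x : FreeNonUnitalNonAssocAlgebra K X) (hx : x ∈ freePart K deg 0) : FreeRel (x * x)
  | odd_self (x : FreeNonUnitalNonAssocAlgebra K X) (hx : x ∈ freePart K deg 1) :
      FreeRel (x * (x * x))

/-- The two-sided ideal generated by the defining relations. -/
def freeIdeal : Submodule K (FreeNonUnitalNonAssocAlgebra K X) :=
  sInf {J | (∀ r, FreeRel K deg r → r ∈ J) ∧ ∀ x, ∀ y ∈ J, x * y ∈ J ∧ y * x ∈ J}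

variable {K deg} in
theorem freeIdeal_rel {r : FreeNonUnitalNonAssocAlgebra K X} (hr : FreeRel K deg r) :
    r ∈ freeIdeal K deg :=
  Submodule.mem_sInf.2 fun _ hJ => hJ.1 r hr

theorem freeIdeal_mul (x : FreeNonUnitalNonAssocAlgebra K X) {y : FreeNonUnitalNonAssocAlgebra K X}
    (hy : y ∈ freeIdeal K deg) : x * y ∈ freeIdeal K deg ∧ y * x ∈ freeIdeal K deg :=
  ⟨Submodule.mem_sInf.2 fun J hJ => (hJ.2 x y (Submodule.mem_sInf.1 hy J hJ)).1,
    Submodule.mem_sInf.2 fun J hJ => (hJ.2 x y (Submodule.mem_sInf.1 hy J hJ)).2⟩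

variable {K deg} in
theorem FreeRel.exists_mem {r : FreeNonUnitalNonAssocAlgebra K X} (hr : FreeRel K deg r) :
    ∃ i, r ∈ freePart K deg i := by
  cases hr with
  | skew i j x y hx hy =>
    exact ⟨i + j, add_mem (freePart_mul K deg hx hy)
      (Submodule.smul_mem _ _ (add_comm j i ▸ freePart_mul K deg hy hx))⟩
  | jacobi i j k x y z hx hy hz =>
    refine ⟨i + (j + k), sub_mem (sub_mem (freePart_mul K deg hx (freePart_mul K deg hy hz)) ?_)
      (Submodule.smul_mem _ _ ?_)⟩
    · exact add_assoc i j k ▸ freePart_mul K deg (freePart_mul K deg hx hy) hz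
    · exact add_left_comm i j k ▸ freePart_mul K deg hy (freePart_mul K deg hx hz)
  | even_self x hx => exact ⟨_, freePart_mul K deg hx hx⟩
  | odd_self x hx => exact ⟨_, freePart_mul K deg hx (freePart_mul K deg hx hx)⟩

theorem freeIdeal_homogeneous :
    letI := freeSuper K deg
    IsHomogeneous (freeIdeal K deg) := by
  let _ := freeSuper K deg
  have mem : ∀ i, ∀ x ∈ freeIdeal K deg, x ∈ freePart K deg i →
      x ∈ (freeIdeal K deg ⊓ part K (FreeNonUnitalNonAssocAlgebra K X) 0) ⊔
        (freeIdeal K deg ⊓ part K (FreeNonUnitalNonAssocAlgebra K X) 1) := by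
    intro i x hx hi
    obtain rfl | rfl : i = 0 ∨ i = 1 := by clear * -; revert i; decide
    · exact Submodule.mem_sup_left ⟨hx, hi⟩
    · exact Submodule.mem_sup_right ⟨hx, hi⟩
  refine sInf_le ⟨fun r hr => ?_, fun x y hy => ?_⟩
  · obtain ⟨i, hi⟩ := hr.exists_mem
    exact mem i r (freeIdeal_rel hr) hi
  · obtain ⟨a, ha, b, hb, rfl⟩ := Submodule.mem_sup.1 hy
    obtain ⟨c, hc, d, hd, rfl⟩ := exists_add K x
    have key : ∀ i j, ∀ u, u ∈ freePart K deg i → ∀ v ∈ freeIdeal K deg, v ∈ freePart K deg j →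
        u * v ∈ (freeIdeal K deg ⊓ part K (FreeNonUnitalNonAssocAlgebra K X) 0) ⊔
        (freeIdeal K deg ⊓ part K (FreeNonUnitalNonAssocAlgebra K X) 1) ∧
        v * u ∈ (freeIdeal K deg ⊓ part K (FreeNonUnitalNonAssocAlgebra K X) 0) ⊔
        (freeIdeal K deg ⊓ part K (FreeNonUnitalNonAssocAlgebra K X) 1) := fun i j u hu v hv hv' =>
      ⟨mem _ _ (freeIdeal_mul K deg u hv).1 (freePart_mul K deg hu hv'),
        mem _ _ (freeIdeal_mul K deg u hv).2 (freePart_mul K deg hv' hu)⟩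
    simp only [add_mul, mul_add]
    have ca := key _ _ c hc a ha.1 ha.2
    have cb := key _ _ c hc b hb.1 hb.2
    have da := key _ _ d hd a ha.1 ha.2
    have db := key _ _ d hd b hb.1 hb.2
    refine ⟨?_, ?_⟩
    · exact add_mem (add_mem ca.1 da.1) (add_mem cb.1 db.1)
    · exact add_mem (add_mem ca.2 cb.2) (add_mem da.2 db.2)

/-- The free Lie superalgebra over `K` on the `ℤ/2`-graded set `X` (with degree map `deg`). -/
def FreeLieSuperalgebra : Type _ := FreeNonUnitalNonAssocAlgebra K X ⧸ freeIdeal K deg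

instance : AddCommGroup (FreeLieSuperalgebra K deg) :=
  inferInstanceAs (AddCommGroup (FreeNonUnitalNonAssocAlgebra K X ⧸ freeIdeal K deg))

instance : Module K (FreeLieSuperalgebra K deg) :=
  inferInstanceAs (Module K (FreeNonUnitalNonAssocAlgebra K X ⧸ freeIdeal K deg))

/-- The class in the free Lie superalgebra of an element of the free non-associative algebra. -/
def freeMk : FreeNonUnitalNonAssocAlgebra K X →ₗ[K] FreeLieSuperalgebra K deg :=
  (freeIdeal K deg).mkQ

theorem freeMk_surjective : Function.Surjective (freeMk K deg) :=
  (freeIdeal K deg).mkQ_surjective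

theorem freeMk_eq_zero {x : FreeNonUnitalNonAssocAlgebra K X} (hx : x ∈ freeIdeal K deg) :
    freeMk K deg x = 0 :=
  (Submodule.Quotient.mk_eq_zero (freeIdeal K deg)).2 hx

instance : LieSuperalgebra K (FreeLieSuperalgebra K deg) where
  toSuperModule := letI := freeSuper K deg
    superQuotient (freeIdeal K deg) (freeIdeal_homogeneous K deg)
  bracket := (freeIdeal K deg).liftQ
    (LinearMap.flip ((freeIdeal K deg).liftQ
      (LinearMap.flip ((LinearMap.mul K (FreeNonUnitalNonAssocAlgebra K X)).compr₂ (freeMk K deg)))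
      fun y hy => LinearMap.ext fun x => freeMk_eq_zero K deg (freeIdeal_mul K deg x hy).1))
    fun x hx => LinearMap.ext fun y => by
      obtain ⟨y, rfl⟩ := freeMk_surjective K deg y
      exact freeMk_eq_zero K deg (freeIdeal_mul K deg y hx).2
  bracket_mem := by
    rintro i j _ ⟨x, hx, rfl⟩ _ ⟨y, hy, rfl⟩
    exact ⟨_, freePart_mul K deg hx hy, rfl⟩
  skew := by
    rintro i j _ ⟨x, hx, rfl⟩ _ ⟨y, hy, rfl⟩
    have h := freeMk_eq_zero K deg (freeIdeal_rel (.skew i j x y hx hy))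
    rw [map_add, map_smul] at h
    exact eq_neg_of_add_eq_zero_left h
  jacobi := by
    rintro i j _ ⟨x, hx, rfl⟩ _ ⟨y, hy, rfl⟩ z
    obtain ⟨z, rfl⟩ := freeMk_surjective K deg z
    let _ := freeSuper K deg
    obtain ⟨a, ha, b, hb, rfl⟩ := exists_add K z
    have h0 := freeMk_eq_zero K deg (freeIdeal_rel (.jacobi i j 0 x y a hx hy ha))
    have h1 := freeMk_eq_zero K deg (freeIdeal_rel (.jacobi i j 1 x y b hx hy hb))
    have h : freeMk K deg (x * (y * (a + b)) - (x * y) * (a + b) -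
        sign K i j • (y * (x * (a + b)))) = 0 := by
      rw [← add_zero (0 : FreeLieSuperalgebra K deg)]
      nth_rewrite 1 [← h0]
      rw [← h1, ← map_add]
      congr 1
      simp only [mul_add, smul_add]
      abel
    rw [map_sub, map_sub, map_smul, sub_sub, sub_eq_zero] at h
    exact h
  even_self := by
    rintro _ ⟨x, hx, rfl⟩
    exact freeMk_eq_zero K deg (freeIdeal_rel (.even_self x hx))
  odd_self := by
    rintro _ ⟨x, hx, rfl⟩
    exact freeMk_eq_zero K deg (freeIdeal_rel (.odd_self x hx))

end Free

/-! ### The `c`-nilpotent multiplier -/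

/-- A free presentation `0 → R → F → L → 0` of a Lie superalgebra: a `ℤ/2`-graded set `X` and a
surjective homomorphism to `L` from the free Lie superalgebra `F` on `X`. -/
structure FreePresentation (K : Type u) (L : Type v) [CommRing K] [AddCommGroup L] [Module K L]
    [LieSuperalgebra K L] where
  X : Type w
  deg : X → ZMod 2
  π : LieSuperHom K (FreeLieSuperalgebra K deg) L
  surjective : Function.Surjective π.toLinearMap

namespace FreePresentation

variable {K : Type u} {L : Type v} [CommRing K] [AddCommGroup L] [Module K L]
  [LieSuperalgebra K L] (P : FreePresentation.{u, v, w} K L)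

/-- The free Lie superalgebra `F` of the presentation. -/
abbrev F : Type _ := FreeLieSuperalgebra K P.deg

/-- The kernel `R` of the presentation. -/
def R : SuperIdeal K P.F := P.π.ker

/-- The graded ideal `R ∩ γ_{c+1}(F)` of `F`. -/
def numerator (c : ℕ) : SuperIdeal K P.F := P.R.inf ((SuperIdeal.top K P.F).gamma c)

/-- The `c`-nilpotent multiplier `M^(c)(L) = (R ∩ γ_{c+1}(F)) / γ_{c+1}(R, F)`, computed from the
free presentation `P`, with its induced structure of a Lie superalgebra. -/
abbrev multiplier (c : ℕ) : Type _ := ((P.R.gamma c).restrict (P.numerator c)).Quotient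

end FreePresentation

end

end LieSuper

/-!
Write `F`, `F₁`, `F₂` for the free Lie superalgebras of the three presentations and `R`, `R₁`, `R₂`
for their kernels. By freeness, the inclusions and projections of `L₁ × L₂` lift to homomorphisms
between `F` and `F₁`, `F₂`. Homomorphisms which agree modulo `R` agree on `γ₃` modulo `γ₃(R, F)`
(`map_sub_map_mem_gamma_two`), so these lifts make the multipliers of `L₁` and `L₂` direct summands
of that of `L₁ × L₂`. In particular no separate proof of independence of the presentation and no
free product of `F₁` and `F₂` are needed.

The rest consists of mixed brackets. Since `F = F₁ + F₂ + R`, trilinearity and the Jacobi identity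
show that `γ₃(F)` is spanned modulo `γ₃(R, F)` by `γ₃(F₁)`, `γ₃(F₂)` and the brackets
`[[F₂, F₁], F₁]` and `[[F₁, F₂], F₂]` (`gamma_two_top_le`). As `[F₂, F₁] ⊆ R`, the class of
`[[y, x], x']` depends only on the images of `y`, `x`, `x'` in the abelianizations, and this gives
maps from `L₂ᵃᵇ ⊗ L₁ᵃᵇ ⊗ L₁ᵃᵇ` and `L₁ᵃᵇ ⊗ L₂ᵃᵇ ⊗ L₂ᵃᵇ` onto the mixed parts (`exists_tensor_map`).

That these maps are injective, and independent of each other and of the first two summands, is seen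
in the tensor algebra of `V = L₁ᵃᵇ ⊕ L₂ᵃᵇ`, truncated above degree `3`. It is a Lie superalgebra
under the supercommutator, over any `K`, and `F → V` lifts to a homomorphism from `F` to it
(`exists_cubic`). The elements of `R` have no linear component, so `γ₃(R, F)` has no cubic component.
In the cubic component of `[[y, x], x']`, the only monomial in `V₂ ⊗ V₁ ⊗ V₁` is `y ⊗ x ⊗ x'`, so the
projection to that summand inverts the map above and kills all the other parts
(`exists_tensor_projection`); exchanging the roles of `L₁` and `L₂` handles the other tensor product.

In Lean, the index of `SuperIdeal.gamma` is shifted, so `I.gamma 2` is `γ₃(I, L)`. To avoid splitting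
elements into homogeneous components, the sign rules are expressed with the projection `x ↦ x₁` to
the odd part, as in `[x, y] = -[y, x] + 2 [y₁, x₁]` (`br_skew`, `br_jacobi`).
-/

namespace LieSuper

/-! ### Homogeneous elements and even maps -/

section Even

variable {K : Type*} [CommRing K] {V W U : Type*} [AddCommGroup V] [Module K V] [SuperModule K V]
  [AddCommGroup W] [Module K W] [SuperModule K W] [AddCommGroup U] [Module K U] [SuperModule K U]

theorem sign_add_right (i j k : ZMod 2) : sign K i (j + k) = sign K i j * sign K i k := by
  have h : ∀ i : ZMod 2, i = 0 ∨ i = 1 := by decide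
  obtain rfl | rfl := h i <;> obtain rfl | rfl := h j <;> obtain rfl | rfl := h k <;>
    simp [sign, ZMod.val_one, show (1 + 1 : ZMod 2) = 0 from rfl]

theorem sign_comm (i j : ZMod 2) : sign K i j = sign K j i := by
  rw [sign, sign, mul_comm]

theorem sign_mul_self (i j : ZMod 2) : sign K i j * sign K i j = 1 := by
  rw [sign, ← mul_pow]; simp

/-- A linear map of supermodules is even if it preserves the degree. -/
def IsEven (f : V →ₗ[K] W) : Prop := ∀ i, ∀ x ∈ part K V i, f x ∈ part K W i

theorem IsEven.comp {g : W →ₗ[K] U} {f : V →ₗ[K] W} (hg : IsEven g) (hf : IsEven f) :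
    IsEven (g ∘ₗ f) := fun i x hx => hg i _ (hf i x hx)

theorem isEven_fst : IsEven (LinearMap.fst K V W) := fun _ _ hx => hx.1

theorem isEven_snd : IsEven (LinearMap.snd K V W) := fun _ _ hx => hx.2

theorem tmul_mem_part {i j : ZMod 2} {x : V} (hx : x ∈ part K V i) {y : W} (hy : y ∈ part K W j) :
    x ⊗ₜ[K] y ∈ part K (V ⊗[K] W) (i + j) :=
  Submodule.mem_iSup_of_mem i
    (Submodule.apply_mem_map₂ (TensorProduct.mk K V W) hx (by rwa [add_sub_cancel_left]))

/-- A submodule contains the component of degree `k` of a tensor product as soon as it contains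
the tensors of homogeneous elements of total degree `k`. -/
theorem part_tensor_le {k : ZMod 2} {S : Submodule K (V ⊗[K] W)}
    (h : ∀ i j, i + j = k → ∀ x ∈ part K V i, ∀ y ∈ part K W j, x ⊗ₜ[K] y ∈ S) :
    part K (V ⊗[K] W) k ≤ S :=
  iSup_le fun i => Submodule.map₂_le.2 fun x hx y hy => h i (k - i) (by abel) x hx y hy

theorem IsEven.tensorMap {V' W' : Type*} [AddCommGroup V'] [Module K V'] [SuperModule K V']
    [AddCommGroup W'] [Module K W'] [SuperModule K W'] {f : V →ₗ[K] V'} {g : W →ₗ[K] W'}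
    (hf : IsEven f) (hg : IsEven g) : IsEven (TensorProduct.map f g) := by
  intro k
  refine part_tensor_le (S := (part K (V' ⊗[K] W') k).comap (TensorProduct.map f g)) ?_
  rintro i j rfl x hx y hy
  exact tmul_mem_part (hf i x hx) (hg j y hy)

theorem isEven_id : IsEven (LinearMap.id : V →ₗ[K] V) := fun _ _ hx => hx

theorem isEven_tensorComm : IsEven (TensorProduct.comm K V W).toLinearMap := by
  intro k
  refine part_tensor_le
    (S := (part K (W ⊗[K] V) k).comap (TensorProduct.comm K V W).toLinearMap) ?_
  rintro i j rfl x hx y hy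
  have := tmul_mem_part hy hx
  rwa [add_comm] at this

theorem isEven_tensorAssoc_symm : IsEven (TensorProduct.assoc K V W U).symm.toLinearMap := by
  intro k
  refine part_tensor_le
    (S := (part K ((V ⊗[K] W) ⊗[K] U) k).comap (TensorProduct.assoc K V W U).symm.toLinearMap) ?_
  rintro i j rfl x hx y hy
  refine part_tensor_le (S := ((part K ((V ⊗[K] W) ⊗[K] U) (i + j)).comap
    (TensorProduct.assoc K V W U).symm.toLinearMap).comap (TensorProduct.mk K V (W ⊗[K] U) x)) ?_ hy
  rintro j₁ j₂ rfl y hy z hz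
  have := tmul_mem_part (tmul_mem_part hx hy) hz
  rwa [add_assoc] at this

/-- A homogeneous element in the image of an even map has a preimage of the same degree. -/
theorem IsEven.exists_preimage {f : V →ₗ[K] W} (hf : IsEven f) {i : ZMod 2} {x : V}
    (hx : f x ∈ part K W i) : ∃ y ∈ part K V i, f y = f x := by
  obtain ⟨a, ha, b, hb, rfl⟩ := exists_add K x
  rw [map_add] at hx
  obtain rfl | rfl : i = 0 ∨ i = 1 := by clear * -; revert i; decide
  · refine ⟨a, ha, ?_⟩
    have := add_unique hx (zero_mem _) (hf 0 a ha) (hf 1 b hb) (add_zero _)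
    rw [map_add, this.1]
  · refine ⟨b, hb, ?_⟩
    have := add_unique (zero_mem _) hx (hf 0 a ha) (hf 1 b hb) (zero_add _)
    rw [map_add, this.2]

variable (K V) in
/-- The projection of a supermodule onto its odd part. -/
noncomputable def odd : V →ₗ[K] V :=
  Submodule.projection _ _ (SuperModule.isCompl (K := K) (V := V)).symm

theorem odd_of_mem_one {x : V} (hx : x ∈ part K V 1) : odd K V x = x :=
  Submodule.projection_apply_left (SuperModule.isCompl (K := K) (V := V)).symm ⟨x, hx⟩

theorem odd_of_mem_zero {x : V} (hx : x ∈ part K V 0) : odd K V x = 0 :=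
  Submodule.projection_apply_right (SuperModule.isCompl (K := K) (V := V)).symm ⟨x, hx⟩

theorem IsEven.map_odd {f : V →ₗ[K] W} (hf : IsEven f) (x : V) :
    f (odd K V x) = odd K W (f x) := by
  obtain ⟨a, ha, b, hb, rfl⟩ := exists_add K x
  simp only [map_add, odd_of_mem_zero ha, odd_of_mem_one hb, odd_of_mem_zero (hf 0 a ha),
    odd_of_mem_one (hf 1 b hb), map_zero]

end Even

/-! ### The supercommutator bracket -/

section Supercommutator

variable {K : Type*} [CommRing K] {A : Type*} [AddCommGroup A] [Module K A] [SuperModule K A]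

/-- The supercommutator of a bilinear product. On homogeneous elements it is
`xy - (-1)^{|x||y|} yx`, so that in general it is `xy - yx + 2 y₁x₁`, where `x₁`, `y₁` are the odd
components. -/
noncomputable def supercommutator (m : A →ₗ[K] A →ₗ[K] A) : A →ₗ[K] A →ₗ[K] A :=
  m - m.flip + (2 : K) • (m.compl₁₂ (odd K A) (odd K A)).flip

theorem supercommutator_apply (m : A →ₗ[K] A →ₗ[K] A) (x y : A) :
    supercommutator m x y = m x y - m y x + (2 : K) • m (odd K A y) (odd K A x) := rfl

theorem supercommutator_of_mem (m : A →ₗ[K] A →ₗ[K] A) {i j : ZMod 2} {x y : A}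
    (hx : x ∈ part K A i) (hy : y ∈ part K A j) :
    supercommutator m x y = m x y - sign K i j • m y x := by
  rw [supercommutator_apply]
  have h : ∀ i : ZMod 2, i = 0 ∨ i = 1 := by decide
  obtain rfl | rfl := h i
  · simp [odd_of_mem_zero hx, sign]
  obtain rfl | rfl := h j
  · simp [odd_of_mem_zero hy, sign]
  · rw [odd_of_mem_one hx, odd_of_mem_one hy, show sign K 1 1 = -1 by simp [sign, ZMod.val_one]]
    module

/-- An associative superalgebra is a Lie superalgebra under the supercommutator. -/
@[reducible]
noncomputable def supercommutatorLie (m : A →ₗ[K] A →ₗ[K] A)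
    (hm : ∀ i j : ZMod 2, ∀ x ∈ part K A i, ∀ y ∈ part K A j, m x y ∈ part K A (i + j))
    (assoc : ∀ x y z, m x (m y z) = m (m x y) z) : LieSuperalgebra K A :=
  have mem : ∀ i j : ZMod 2, ∀ x ∈ part K A i, ∀ y ∈ part K A j,
      supercommutator m x y ∈ part K A (i + j) := by
    intro i j x hx y hy
    rw [supercommutator_of_mem m hx hy]
    exact sub_mem (hm i j x hx y hy)
      (Submodule.smul_mem _ _ (add_comm j i ▸ hm j i y hy x hx))
  { toSuperModule := inferInstance
    bracket := supercommutator m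
    bracket_mem := mem
    skew := by
      intro i j x hx y hy
      rw [supercommutator_of_mem m hx hy, supercommutator_of_mem m hy hx, smul_sub, smul_smul,
        sign_comm j i, sign_mul_self, one_smul, neg_sub]
    jacobi := by
      intro i j x hx y hy z
      refine super_induction K (p := fun z => supercommutator m x (supercommutator m y z) =
        supercommutator m (supercommutator m x y) z +
          sign K i j • supercommutator m y (supercommutator m x z)) z (fun z z' h h' => ?_)
        fun k z hz => ?_
      · simp only [map_add, h, h', smul_add]
        abel
      · rw [supercommutator_of_mem m hx (mem j k y hy z hz),
          supercommutator_of_mem m (mem i j x hx y hy) hz,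
          supercommutator_of_mem m hy (mem i k x hx z hz),
          supercommutator_of_mem m hx hy, supercommutator_of_mem m hy hz,
          supercommutator_of_mem m hx hz]
        simp only [map_sub, map_smul, LinearMap.sub_apply, LinearMap.smul_apply, smul_sub,
          smul_smul, assoc, sign_add_right, sign_comm (i + j) k, sign_comm j i, sign_comm k i,
          sign_comm k j]
        have h := sign_mul_self (K := K) i j
        -- Every monomial in `x`, `y`, `z` has the same coefficient on both sides, up to the
        -- relation `sign K i j ^ 2 = 1`.
        match_scalars
        all_goals first
          | ring1
          | linear_combination sign K j k * h
          | linear_combination -(sign K i k * sign K j k) * h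
    even_self := fun x hx => by
      rw [supercommutator_of_mem m hx hx]; simp [sign]
    odd_self := fun x hx => by
      rw [supercommutator_of_mem m hx (mem 1 1 x hx x hx), supercommutator_of_mem m hx hx]
      simp [assoc, sign, show (1 + 1 : ZMod 2) = 0 from rfl] }

end Supercommutator

/-! ### The truncated tensor algebra -/

/-- The augmentation ideal of the tensor algebra of `V`, modulo tensors of degree at least `4`. -/
def TruncatedTensor (K : Type*) [CommRing K] (V : Type*) [AddCommGroup V] [Module K V] : Type _ :=
  V × (V ⊗[K] V) × ((V ⊗[K] V) ⊗[K] V)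

namespace TruncatedTensor

section Mul

variable (K : Type*) [CommRing K] (V : Type*) [AddCommGroup V] [Module K V]

noncomputable instance : AddCommGroup (TruncatedTensor K V) :=
  inferInstanceAs (AddCommGroup (V × (V ⊗[K] V) × ((V ⊗[K] V) ⊗[K] V)))

noncomputable instance : Module K (TruncatedTensor K V) :=
  inferInstanceAs (Module K (V × (V ⊗[K] V) × ((V ⊗[K] V) ⊗[K] V)))

/-- The component of degree `1`. -/
noncomputable def fst : TruncatedTensor K V →ₗ[K] V := LinearMap.fst K _ _

/-- The component of degree `2`. -/
noncomputable def snd : TruncatedTensor K V →ₗ[K] V ⊗[K] V :=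
  LinearMap.fst K _ _ ∘ₗ LinearMap.snd K _ _

/-- The component of degree `3`. -/
noncomputable def thd : TruncatedTensor K V →ₗ[K] (V ⊗[K] V) ⊗[K] V :=
  LinearMap.snd K _ _ ∘ₗ LinearMap.snd K _ _

variable {K V} in
theorem ext {a b : TruncatedTensor K V} (h₁ : fst K V a = fst K V b) (h₂ : snd K V a = snd K V b)
    (h₃ : thd K V a = thd K V b) : a = b :=
  Prod.ext h₁ (Prod.ext h₂ h₃)

/-- The inclusion of `V` as the component of degree `1`. -/
noncomputable def of : V →ₗ[K] TruncatedTensor K V := LinearMap.inl K _ _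

/-- The product of the truncated tensor algebra. -/
noncomputable def mul :
    TruncatedTensor K V →ₗ[K] TruncatedTensor K V →ₗ[K] TruncatedTensor K V :=
  LinearMap.mk₂ K
    (fun a b => ((0, fst K V a ⊗ₜ[K] fst K V b,
      (TensorProduct.assoc K V V V).symm (fst K V a ⊗ₜ[K] snd K V b) + snd K V a ⊗ₜ[K] fst K V b) :
        V × (V ⊗[K] V) × ((V ⊗[K] V) ⊗[K] V)))
    (fun a a' b => Prod.ext (add_zero 0).symm (Prod.ext
      (by simp only [map_add, TensorProduct.add_tmul]; rfl)
      (by simp only [map_add, TensorProduct.add_tmul]; exact add_add_add_comm _ _ _ _)))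
    (fun r a b => Prod.ext (smul_zero r).symm (Prod.ext
      (by simp only [map_smul]; rfl)
      (by simp only [map_smul, ← TensorProduct.smul_tmul']; exact (smul_add _ _ _).symm)))
    (fun a b b' => Prod.ext (add_zero 0).symm (Prod.ext
      (by simp only [map_add, TensorProduct.tmul_add]; rfl)
      (by simp only [map_add, TensorProduct.tmul_add]; exact add_add_add_comm _ _ _ _)))
    (fun r a b => Prod.ext (smul_zero r).symm (Prod.ext
      (by simp only [map_smul, TensorProduct.tmul_smul]; rfl)
      (by simp only [map_smul, TensorProduct.tmul_smul]; exact (smul_add _ _ _).symm)))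

variable {K V}

@[simp]
theorem fst_of (x : V) : fst K V (of K V x) = x := rfl

@[simp]
theorem fst_mul (a b : TruncatedTensor K V) : fst K V (mul K V a b) = 0 := rfl

@[simp]
theorem snd_mul (a b : TruncatedTensor K V) :
    snd K V (mul K V a b) = fst K V a ⊗ₜ[K] fst K V b := rfl

@[simp]
theorem thd_mul (a b : TruncatedTensor K V) : thd K V (mul K V a b) =
    (TensorProduct.assoc K V V V).symm (fst K V a ⊗ₜ[K] snd K V b) +
      snd K V a ⊗ₜ[K] fst K V b := rfl

theorem mul_mul (a b c : TruncatedTensor K V) :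
    mul K V a (mul K V b c) = mul K V (mul K V a b) c := by
  refine ext ?_ ?_ ?_ <;> simp

variable {V₁ V₂ : Type*} [AddCommGroup V₁] [Module K V₁] [AddCommGroup V₂] [Module K V₂]

theorem map_assoc_symm (s : V →ₗ[K] V₂) (t : V →ₗ[K] V₁) (z : V) (w : V ⊗[K] V) :
    TensorProduct.map (TensorProduct.map s t) t ((TensorProduct.assoc K V V V).symm (z ⊗ₜ w)) =
      (TensorProduct.assoc K V₂ V₁ V₁).symm (s z ⊗ₜ TensorProduct.map t t w) := by
  induction w with
  | zero => simp
  | add a b ha hb => simp [TensorProduct.tmul_add, ha, hb]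
  | tmul a b => simp

end Mul

variable {K : Type*} [CommRing K] {V : Type*} [AddCommGroup V] [Module K V] [SuperModule K V]

noncomputable instance : SuperModule K (TruncatedTensor K V) :=
  inferInstanceAs (SuperModule K (V × (V ⊗[K] V) × ((V ⊗[K] V) ⊗[K] V)))

theorem isEven_fst : IsEven (fst K V) := fun _ _ hx => hx.1

theorem isEven_snd : IsEven (snd K V) := fun _ _ hx => hx.2.1

theorem isEven_thd : IsEven (thd K V) := fun _ _ hx => hx.2.2

theorem isEven_of : IsEven (of K V) := fun _ _ hx => ⟨hx, zero_mem _, zero_mem _⟩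

theorem mul_mem (i j : ZMod 2) (a : TruncatedTensor K V) (ha : a ∈ part K (TruncatedTensor K V) i)
    (b : TruncatedTensor K V) (hb : b ∈ part K (TruncatedTensor K V) j) :
    mul K V a b ∈ part K (TruncatedTensor K V) (i + j) :=
  ⟨zero_mem _, tmul_mem_part (isEven_fst i a ha) (isEven_fst j b hb),
    add_mem (isEven_tensorAssoc_symm _ _ (tmul_mem_part (isEven_fst i a ha) (isEven_snd j b hb)))
      (tmul_mem_part (isEven_snd i a ha) (isEven_fst j b hb))⟩

/-- The supercommutator `[x, y] = xy - yx + 2 y₁x₁` in the tensor algebra of `V`, where `x₁`, `y₁`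
are the odd components. -/
noncomputable def doubleBracket (x y : V) : V ⊗[K] V :=
  x ⊗ₜ y - y ⊗ₜ x + (2 : K) • odd K V y ⊗ₜ odd K V x

/-- The iterated supercommutator `[[x, y], z]` in the tensor algebra of `V`. -/
noncomputable def tripleBracket (x y z : V) : (V ⊗[K] V) ⊗[K] V :=
  doubleBracket x y ⊗ₜ z - (TensorProduct.assoc K V V V).symm (z ⊗ₜ doubleBracket x y) +
    (2 : K) • (TensorProduct.assoc K V V V).symm
      (odd K V z ⊗ₜ odd K (V ⊗[K] V) (doubleBracket x y))

theorem fst_supercommutator (a b : TruncatedTensor K V) :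
    fst K V (supercommutator (mul K V) a b) = 0 := by
  simp [supercommutator_apply]

theorem snd_supercommutator (a b : TruncatedTensor K V) :
    snd K V (supercommutator (mul K V) a b) = doubleBracket (fst K V a) (fst K V b) := by
  simp [supercommutator_apply, doubleBracket, isEven_fst.map_odd]

theorem thd_supercommutator (a b c : TruncatedTensor K V) :
    thd K V (supercommutator (mul K V) (supercommutator (mul K V) a b) c) =
      tripleBracket (fst K V a) (fst K V b) (fst K V c) := by
  rw [supercommutator_apply]
  simp [isEven_fst.map_odd, isEven_snd.map_odd, snd_supercommutator,
    fst_supercommutator, tripleBracket]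

noncomputable instance : LieSuperalgebra K (TruncatedTensor K V) :=
  supercommutatorLie (mul K V) mul_mem mul_mul

theorem fst_br (a b : TruncatedTensor K V) : fst K V (br K a b) = 0 :=
  fst_supercommutator a b

/-- The cubic component of `[[a, b], c]` depends only on the linear components of `a`, `b`, `c`. -/
theorem thd_br_br (a b c : TruncatedTensor K V) :
    thd K V (br K (br K a b) c) = tripleBracket (fst K V a) (fst K V b) (fst K V c) :=
  thd_supercommutator a b c

theorem tripleBracket_zero_left (y z : V) : tripleBracket (K := K) 0 y z = 0 := by
  simp [tripleBracket, doubleBracket]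

variable {V₁ V₂ : Type*} [AddCommGroup V₁] [Module K V₁] [AddCommGroup V₂] [Module K V₂]
  {s : V →ₗ[K] V₂} {t : V →ₗ[K] V₁}

/-- Of all the monomials of `[[x, y], z]` in the tensor algebra, only `xyz` survives if the first
factor is projected by a map which kills `y` and `z`. -/
theorem map_tripleBracket [SuperModule K V₂] (hs : IsEven s) (x : V) {y z : V} (hy : s y = 0)
    (hz : s z = 0) :
    TensorProduct.map (TensorProduct.map s t) t (tripleBracket x y z) = (s x ⊗ₜ t y) ⊗ₜ t z := by
  simp [tripleBracket, doubleBracket, map_assoc_symm, hs.map_odd, hy, hz]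

/-- No monomial of `[[x, y], z]` survives in the tensor algebra if two of its factors are
projected by a map which kills `y` and `z`. -/
theorem map_tripleBracket_eq_zero [SuperModule K V₁] (ht : IsEven t) (x : V) {y z : V}
    (hy : t y = 0) (hz : t z = 0) :
    TensorProduct.map (TensorProduct.map s t) t (tripleBracket x y z) = 0 := by
  simp [tripleBracket, map_assoc_symm, (ht.tensorMap ht).map_odd]
  simp [doubleBracket, ht.map_odd, hy, hz]

end TruncatedTensor

/-! ### Homomorphisms of Lie superalgebras -/

namespace LieSuperHom

variable {K : Type*} [CommRing K] {L L' L'' : Type*} [AddCommGroup L] [Module K L]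
  [LieSuperalgebra K L] [AddCommGroup L'] [Module K L'] [LieSuperalgebra K L']
  [AddCommGroup L''] [Module K L''] [LieSuperalgebra K L'']

instance : CoeFun (LieSuperHom K L L') fun _ => L → L' := ⟨fun f => f.toLinearMap⟩

theorem isEven (f : LieSuperHom K L L') : IsEven f.toLinearMap := f.map_part

theorem map_bracket (f : LieSuperHom K L L') (x y : L) : f (br K x y) = br K (f x) (f y) :=
  f.map_br x y

/-- The composition of two homomorphisms. -/
def comp (g : LieSuperHom K L' L'') (f : LieSuperHom K L L') : LieSuperHom K L L'' where
  toLinearMap := g.toLinearMap ∘ₗ f.toLinearMap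
  map_part := g.isEven.comp f.isEven
  map_br x y := (congrArg g (f.map_bracket x y)).trans (g.map_bracket _ _)

variable (K L L')

/-- The identity homomorphism. -/
def id : LieSuperHom K L L where
  toLinearMap := LinearMap.id
  map_part := isEven_id
  map_br _ _ := rfl

/-- The inclusion of the first summand. -/
def inl : LieSuperHom K L (L × L') where
  toLinearMap := LinearMap.inl K L L'
  map_part _ _ hx := ⟨hx, zero_mem _⟩
  map_br _ _ := Prod.ext rfl (map_zero (LieSuperalgebra.bracket (K := K) (0 : L'))).symm

/-- The inclusion of the second summand. -/
def inr : LieSuperHom K L' (L × L') where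
  toLinearMap := LinearMap.inr K L L'
  map_part _ _ hx := ⟨zero_mem _, hx⟩
  map_br _ _ := Prod.ext (map_zero (LieSuperalgebra.bracket (K := K) (0 : L))).symm rfl

/-- The projection to the first summand. -/
def fst : LieSuperHom K (L × L') L where
  toLinearMap := LinearMap.fst K L L'
  map_part _ _ hx := hx.1
  map_br _ _ := rfl

/-- The projection to the second summand. -/
def snd : LieSuperHom K (L × L') L' where
  toLinearMap := LinearMap.snd K L L'
  map_part _ _ hx := hx.2
  map_br _ _ := rfl

end LieSuperHom

/-! ### The universal property of free Lie superalgebras -/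

section FreeLift

variable {K : Type*} [CommRing K] {X : Type*} {deg : X → ZMod 2}

variable (K deg) in
/-- The generator of the free Lie superalgebra indexed by `x`. -/
noncomputable def gen (x : X) : FreeLieSuperalgebra K deg :=
  freeMk K deg (FreeNonUnitalNonAssocAlgebra.of K x)

/-- The free Lie superalgebra is generated by its generators as an algebra. -/
theorem mem_of_gen_mem {S : Submodule K (FreeLieSuperalgebra K deg)}
    (hgen : ∀ x, gen K deg x ∈ S) (hbr : ∀ a ∈ S, ∀ b ∈ S, br K a b ∈ S)
    (a : FreeLieSuperalgebra K deg) : a ∈ S := by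
  obtain ⟨a, rfl⟩ := freeMk_surjective K deg a
  have h : ∀ w : FreeMagma X, freeMk K deg (MonoidAlgebra.single w 1) ∈ S := by
    intro w
    induction w with
    | ih1 x => exact hgen x
    | ih2 u v hu hv =>
      have := hbr _ hu _ hv
      have e : br K (freeMk K deg (MonoidAlgebra.single u 1))
        (freeMk K deg (MonoidAlgebra.single v 1)) =
          freeMk K deg (MonoidAlgebra.single u 1 * MonoidAlgebra.single v 1) := rfl
      rw [e, MonoidAlgebra.single_mul_single, one_mul] at this
      exact this
  have h' : ∀ i, freePart K deg i ≤ S.comap (freeMk K deg) := by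
    intro i
    refine Submodule.span_le.2 ?_
    rintro _ ⟨w, -, rfl⟩
    exact h w
  let _ := freeSuper K deg
  exact super_induction K (p := fun a => freeMk K deg a ∈ S) a
    (fun a b ha hb => by rw [map_add]; exact add_mem ha hb) h'

theorem hom_eq_of_gen {L : Type*} [AddCommGroup L] [Module K L] [LieSuperalgebra K L]
    {f g : LieSuperHom K (FreeLieSuperalgebra K deg) L}
    (h : ∀ x, f (gen K deg x) = g (gen K deg x)) (a : FreeLieSuperalgebra K deg) : f a = g a :=
  mem_of_gen_mem (S := LinearMap.eqLocus f.toLinearMap g.toLinearMap) h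
    (fun a ha b hb => by
      change f (br K a b) = g (br K a b)
      rw [f.map_bracket, g.map_bracket, show f a = g a from ha, show f b = g b from hb]) a

theorem gen_mem (x : X) : gen K deg x ∈ part K (FreeLieSuperalgebra K deg) (deg x) :=
  ⟨_, Submodule.subset_span ⟨FreeMagma.of x, rfl, rfl⟩, rfl⟩

/-- A map from the generators to a Lie superalgebra which preserves the degree extends to a
homomorphism from the free Lie superalgebra. -/
theorem exists_lift {L : Type*} [AddCommGroup L] [Module K L] [LieSuperalgebra K L]
    (f : X → L) (hf : ∀ x, f x ∈ part K L (deg x)) :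
    ∃ φ : LieSuperHom K (FreeLieSuperalgebra K deg) L, ∀ x, φ (gen K deg x) = f x := by
  -- `L` with its bracket as product, to which the free non-associative algebra maps.
  let _ : NonUnitalNonAssocRing L :=
    { (inferInstance : AddCommGroup L) with
      mul := fun x y => br K x y
      left_distrib := fun x y z => map_add (LieSuperalgebra.bracket (K := K) x) y z
      right_distrib := fun x y z => by
        change br K (x + y) z = br K x z + br K y z
        simp [br]
      zero_mul := fun x => by
        change br K 0 x = 0
        simp [br]
      mul_zero := fun x => map_zero (LieSuperalgebra.bracket (K := K) x) }
  have : IsScalarTower K L L := ⟨fun r x y => by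
    change br K (r • x) y = r • br K x y
    simp [br]⟩
  have : SMulCommClass K L L := ⟨fun r x y => by
    change r • br K x y = br K x (r • y)
    simp [br]⟩
  let φ := FreeNonUnitalNonAssocAlgebra.lift K f
  have hof : ∀ x, φ (FreeNonUnitalNonAssocAlgebra.of K x) = f x := fun x =>
    FreeNonUnitalNonAssocAlgebra.lift_of_apply K f x
  have hmul : ∀ a b, φ (a * b) = br K (φ a) (φ b) := fun a b => map_mul φ a b
  let ψ : FreeNonUnitalNonAssocAlgebra K X →ₗ[K] L := (φ : _ →ₗ[K] L)
  have hmono : ∀ w : FreeMagma X, ψ (MonoidAlgebra.single w 1) ∈ part K L (monoDeg deg w) := by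
    intro w
    induction w with
    | ih1 x => exact (hof x).symm ▸ hf x
    | ih2 u v hu hv =>
      have := LieSuperalgebra.bracket_mem _ _ _ hu _ hv
      have e : br K (ψ (MonoidAlgebra.single u 1)) (ψ (MonoidAlgebra.single v 1)) =
          ψ (MonoidAlgebra.single u 1 * MonoidAlgebra.single v 1) := (hmul _ _).symm
      rw [← br, e, MonoidAlgebra.single_mul_single, one_mul] at this
      exact this
  have hpart : ∀ i, ∀ a ∈ freePart K deg i, φ a ∈ part K L i := by
    intro i a ha
    have : freePart K deg i ≤ (part K L i).comap ψ := by
      refine Submodule.span_le.2 ?_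
      rintro _ ⟨w, rfl, rfl⟩
      exact hmono w
    exact this ha
  have hrel : freeIdeal K deg ≤ LinearMap.ker ψ := by
    refine sInf_le ⟨fun r hr => ?_, fun x y hy => ?_⟩
    · change φ r = 0
      cases hr with
      | skew i j x y hx hy =>
        rw [map_add, map_smul, hmul, hmul, br,
          LieSuperalgebra.skew i j _ (hpart i x hx) _ (hpart j y hy), neg_add_cancel]
      | jacobi i j k x y z hx hy hz =>
        rw [map_sub, map_sub, map_smul, hmul, hmul, hmul, hmul, hmul, hmul, br, br,
          LieSuperalgebra.jacobi i j _ (hpart i x hx) _ (hpart j y hy)]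
        abel
      | even_self x hx => rw [hmul]; exact LieSuperalgebra.even_self _ (hpart 0 x hx)
      | odd_self x hx => rw [hmul, hmul]; exact LieSuperalgebra.odd_self _ (hpart 1 x hx)
    · have hy : φ y = 0 := hy
      constructor
      · change φ (x * y) = 0
        rw [map_mul, hy, mul_zero]
      · change φ (y * x) = 0
        rw [map_mul, hy, zero_mul]
  exact ⟨{ toLinearMap := (freeIdeal K deg).liftQ ψ hrel
           map_part := by
            rintro i _ ⟨x, hx, rfl⟩
            exact hpart i x hx
           map_br := fun x y => by
            obtain ⟨x, rfl⟩ := freeMk_surjective K deg x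
            obtain ⟨y, rfl⟩ := freeMk_surjective K deg y
            exact hmul x y }, hof⟩

/-- Free Lie superalgebras are projective: a homomorphism from a free Lie superalgebra lifts
through any surjection. -/
theorem exists_hom_lift {L L' : Type*} [AddCommGroup L] [Module K L] [LieSuperalgebra K L]
    [AddCommGroup L'] [Module K L'] [LieSuperalgebra K L'] (π : LieSuperHom K L L')
    (hπ : Function.Surjective π) (g : LieSuperHom K (FreeLieSuperalgebra K deg) L') :
    ∃ φ : LieSuperHom K (FreeLieSuperalgebra K deg) L, ∀ a, π (φ a) = g a := by
  have h : ∀ x, ∃ y ∈ part K L (deg x), π y = g (gen K deg x) := by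
    intro x
    obtain ⟨y, hy⟩ := hπ (g (gen K deg x))
    have := π.isEven.exists_preimage (hy.symm ▸ g.isEven _ _ (gen_mem x) : π y ∈ part K L' (deg x))
    rwa [hy] at this
  choose y hy hy' using h
  obtain ⟨φ, hφ⟩ := exists_lift y hy
  refine ⟨φ, hom_eq_of_gen (f := π.comp φ) fun x => ?_⟩
  exact (congrArg π (hφ x)).trans (hy' x)

/-- A homomorphism `v` from a free Lie superalgebra to an abelian one lifts to a homomorphism to
the truncated tensor algebra under the supercommutator; on iterated brackets, its cubic component is given by
iterated supercommutators. -/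
theorem exists_cubic {V : Type*} [AddCommGroup V] [Module K V] [SuperModule K V]
    (v : FreeLieSuperalgebra K deg →ₗ[K] V) (hv : IsEven v) (hbr : ∀ a b, v (br K a b) = 0) :
    ∃ τ : FreeLieSuperalgebra K deg →ₗ[K] (V ⊗[K] V) ⊗[K] V, IsEven τ ∧
      ∀ a b c, τ (br K (br K a b) c) = TruncatedTensor.tripleBracket (v a) (v b) (v c) := by
  obtain ⟨φ, hφ⟩ := exists_lift (L := TruncatedTensor K V)
    (fun x => TruncatedTensor.of K V (v (gen K deg x)))
    (fun x => TruncatedTensor.isEven_of _ _ (hv _ _ (gen_mem x)))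
  have h : ∀ a, TruncatedTensor.fst K V (φ a) = v a :=
    mem_of_gen_mem
      (S := LinearMap.eqLocus (TruncatedTensor.fst K V ∘ₗ φ.toLinearMap) v)
      (fun x => (congrArg (TruncatedTensor.fst K V) (hφ x)).trans (TruncatedTensor.fst_of _))
      (fun a _ b _ => by
        change TruncatedTensor.fst K V (φ (br K a b)) = v (br K a b)
        rw [φ.map_bracket, TruncatedTensor.fst_br, hbr])
  refine ⟨TruncatedTensor.thd K V ∘ₗ φ.toLinearMap,
    TruncatedTensor.isEven_thd.comp φ.isEven, fun a b c => ?_⟩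
  change TruncatedTensor.thd K V (φ _) = _
  rw [φ.map_bracket, φ.map_bracket, TruncatedTensor.thd_br_br, h, h, h]

end FreeLift

/-! ### Brackets of arbitrary elements -/

section Bracket

variable {K : Type*} [CommRing K] {L : Type*} [AddCommGroup L] [Module K L] [LieSuperalgebra K L]

theorem br_add (x y z : L) : br K x (y + z) = br K x y + br K x z := map_add _ _ _

theorem add_br (x y z : L) : br K (x + y) z = br K x z + br K y z := by
  simp [br]

theorem br_sub (x y z : L) : br K x (y - z) = br K x y - br K x z := map_sub _ _ _

theorem sub_br (x y z : L) : br K (x - y) z = br K x z - br K y z := by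
  simp [br]

theorem br_smul (r : K) (x y : L) : br K x (r • y) = r • br K x y := map_smul _ _ _

theorem smul_br (r : K) (x y : L) : br K (r • x) y = r • br K x y := by
  simp [br]

theorem neg_br (x y : L) : br K (-x) y = -br K x y := by
  simp [br]

/-- Super skew-symmetry, for elements which need not be homogeneous: the correction term accounts
for the sign of the odd-odd component. -/
theorem br_skew (x y : L) :
    br K x y = -br K y x + (2 : K) • br K (odd K L y) (odd K L x) := by
  refine super_induction K (p := fun x => br K x y = -br K y x +
    (2 : K) • br K (odd K L y) (odd K L x)) x (fun x x' h h' => ?_) fun i x hx =>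
      super_induction K (p := fun y => br K x y = -br K y x +
        (2 : K) • br K (odd K L y) (odd K L x)) y (fun y y' h h' => ?_) fun j y hy => ?_
  · rw [add_br, h, h', map_add, br_add, br_add]; module
  · rw [br_add, h, h', map_add, add_br, add_br]; module
  · rw [br, LieSuperalgebra.skew i j x hx y hy]
    have h : ∀ i : ZMod 2, i = 0 ∨ i = 1 := by decide
    obtain rfl | rfl := h i
    · simp [odd_of_mem_zero hx, sign, br]
    obtain rfl | rfl := h j
    · simp [odd_of_mem_zero hy, sign, br]
    · rw [odd_of_mem_one hx, odd_of_mem_one hy, show sign K 1 1 = -1 by simp [sign, ZMod.val_one]]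
      module

/-- The super Jacobi identity, for elements which need not be homogeneous. -/
theorem br_jacobi (x y z : L) : br K x (br K y z) = br K (br K x y) z + br K y (br K x z) -
    (2 : K) • br K (odd K L y) (br K (odd K L x) z) := by
  refine super_induction K (p := fun x => br K x (br K y z) = br K (br K x y) z +
    br K y (br K x z) - (2 : K) • br K (odd K L y) (br K (odd K L x) z)) x
    (fun x x' h h' => ?_) fun i x hx =>
      super_induction K (p := fun y => br K x (br K y z) = br K (br K x y) z +
        br K y (br K x z) - (2 : K) • br K (odd K L y) (br K (odd K L x) z)) y
        (fun y y' h h' => ?_) fun j y hy => ?_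
  · simp only [add_br, h, h', map_add]; module
  · simp only [add_br, h, h', map_add]; module
  · rw [br, br, LieSuperalgebra.jacobi i j x hx y hy]
    have h : ∀ i : ZMod 2, i = 0 ∨ i = 1 := by decide
    obtain rfl | rfl := h i
    · simp [odd_of_mem_zero hx, sign, br]
    obtain rfl | rfl := h j
    · simp [odd_of_mem_zero hy, sign, br]
    · rw [odd_of_mem_one hx, odd_of_mem_one hy, show sign K 1 1 = -1 by simp [sign, ZMod.val_one]]
      module

/-- The odd component of a bracket: the odd projection `x ↦ x₁` satisfies
`[x, y]₁ = [x₁, y] + [x, y₁] - 2 [x₁, y₁]`. -/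
theorem odd_br (x y : L) : odd K L (br K x y) = br K (odd K L x) y + br K x (odd K L y) -
    (2 : K) • br K (odd K L x) (odd K L y) := by
  refine super_induction K (p := fun x => odd K L (br K x y) = br K (odd K L x) y +
    br K x (odd K L y) - (2 : K) • br K (odd K L x) (odd K L y)) x
    (fun x x' h h' => ?_) fun i x hx =>
      super_induction K (p := fun y => odd K L (br K x y) = br K (odd K L x) y +
        br K x (odd K L y) - (2 : K) • br K (odd K L x) (odd K L y)) y
        (fun y y' h h' => ?_) fun j y hy => ?_
  · simp only [add_br, h, h', map_add]; module
  · simp only [h, h', map_add]; module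
  · have hxy := LieSuperalgebra.bracket_mem i j x hx y hy
    have h : ∀ i : ZMod 2, i = 0 ∨ i = 1 := by decide
    obtain rfl | rfl := h i <;> obtain rfl | rfl := h j
    · simp [odd_of_mem_zero hx, odd_of_mem_zero hy, odd_of_mem_zero hxy, br]
    · simp [odd_of_mem_zero hx, odd_of_mem_one hy, odd_of_mem_one hxy, br]
    · simp [odd_of_mem_one hx, odd_of_mem_zero hy, odd_of_mem_one hxy, br]
    · rw [odd_of_mem_one hx, odd_of_mem_one hy, odd_of_mem_zero hxy]
      module

end Bracket

theorem IsHomogeneous.odd_mem {K : Type*} [CommRing K] {V : Type*} [AddCommGroup V] [Module K V]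
    [SuperModule K V] {N : Submodule K V} (hN : IsHomogeneous N) {x : V} (hx : x ∈ N) :
    odd K V x ∈ N := by
  obtain ⟨a, -, b, hbN, ha, hb, rfl⟩ := hN.exists_add hx
  rwa [map_add, odd_of_mem_zero ha, odd_of_mem_one hb, zero_add]

/-! ### The series `γ_n(I, L)` -/

namespace SuperIdeal

variable {K : Type*} [CommRing K] {L : Type*} [AddCommGroup L] [Module K L] [LieSuperalgebra K L]
  (I : SuperIdeal K L)

theorem br_mem_comm {J : SuperIdeal K L} {x y : L} (hx : x ∈ I.carrier) (hy : y ∈ J.carrier) :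
    br K x y ∈ (I.comm J).carrier :=
  Submodule.subset_span ⟨x, hx, y, hy, rfl⟩

theorem br_mem_comm_swap {J : SuperIdeal K L} {x y : L} (hx : x ∈ I.carrier)
    (hy : y ∈ J.carrier) : br K y x ∈ (I.comm J).carrier := by
  rw [br_skew]
  exact add_mem (neg_mem (I.br_mem_comm hx hy)) (Submodule.smul_mem _ _
    (I.br_mem_comm (I.homogeneous.odd_mem hx) (J.homogeneous.odd_mem hy)))

theorem comm_le {J : SuperIdeal K L} {S : Submodule K L}
    (h : ∀ x ∈ I.carrier, ∀ y ∈ J.carrier, br K x y ∈ S) : (I.comm J).carrier ≤ S := by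
  refine Submodule.span_le.2 ?_
  rintro _ ⟨x, hx, y, hy, rfl⟩
  exact h x hx y hy

theorem gamma_two_le {S : Submodule K L}
    (h : ∀ x ∈ I.carrier, ∀ y z, br K (br K x y) z ∈ S) : (I.gamma 2).carrier ≤ S := by
  refine comm_le _ fun w hw z _ => ?_
  exact comm_le I (S := S.comap (LieSuperalgebra.bracket (K := K).flip z))
    (fun x hx y _ => h x hx y z) hw

theorem br_br_mem_gamma_two_left {x : L} (hx : x ∈ I.carrier) (y z : L) :
    br K (br K x y) z ∈ (I.gamma 2).carrier :=
  br_mem_comm _ (I.br_mem_comm hx trivial) trivial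

theorem br_br_mem_gamma_two_mid {y : L} (hy : y ∈ I.carrier) (x z : L) :
    br K (br K x y) z ∈ (I.gamma 2).carrier :=
  br_mem_comm _ (I.br_mem_comm_swap hy trivial) trivial

/-- The inclusion `[I, [L, L]] ⊆ [[I, L], L]`. -/
theorem br_mem_gamma_two {x w : L} (hx : x ∈ I.carrier)
    (hw : w ∈ ((top K L).comm (top K L)).carrier) : br K x w ∈ (I.gamma 2).carrier := by
  refine comm_le (top K L) (S := (I.gamma 2).carrier.comap (LieSuperalgebra.bracket (K := K) x))
    (fun y _ z _ => ?_) hw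
  change br K x (br K y z) ∈ (I.gamma 2).carrier
  rw [br_jacobi]
  exact sub_mem (add_mem (I.br_br_mem_gamma_two_left hx y z)
    (br_mem_comm_swap _ (I.br_mem_comm hx trivial) trivial))
    (Submodule.smul_mem _ _ (br_mem_comm_swap _
      (I.br_mem_comm (I.homogeneous.odd_mem hx) trivial) trivial))

theorem br_br_mem_gamma_two_right {z : L} (hz : z ∈ I.carrier) (x y : L) :
    br K (br K x y) z ∈ (I.gamma 2).carrier := by
  have hxy := (top K L).br_mem_comm (J := top K L) (x := x) (y := y) trivial trivial
  rw [br_skew]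
  exact add_mem (neg_mem (I.br_mem_gamma_two hz hxy)) (Submodule.smul_mem _ _
    (I.br_mem_gamma_two (I.homogeneous.odd_mem hz)
      (((top K L).comm (top K L)).homogeneous.odd_mem hxy)))

variable {L' : Type*} [AddCommGroup L'] [Module K L'] [LieSuperalgebra K L']
  {I} {I' : SuperIdeal K L'}

theorem map_mem_gamma_two (φ : LieSuperHom K L L')
    (h : ∀ x ∈ I.carrier, φ x ∈ I'.carrier) {w : L} (hw : w ∈ (I.gamma 2).carrier) :
    φ w ∈ (I'.gamma 2).carrier := by
  refine I.gamma_two_le (S := (I'.gamma 2).carrier.comap φ.toLinearMap) (fun x hx y z => ?_) hw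
  change φ _ ∈ (I'.gamma 2).carrier
  rw [φ.map_bracket, φ.map_bracket]
  exact I'.br_br_mem_gamma_two_left (h x hx) _ _

/-- Homomorphisms which agree modulo `I'` agree on `γ₃` modulo `γ₃(I', L')`. -/
theorem map_sub_map_mem_gamma_two (φ ψ : LieSuperHom K L L')
    (h : ∀ x, φ x - ψ x ∈ I'.carrier) {w : L} (hw : w ∈ ((top K L).gamma 2).carrier) :
    φ w - ψ w ∈ (I'.gamma 2).carrier := by
  refine (top K L).gamma_two_le
    (S := (I'.gamma 2).carrier.comap (φ.toLinearMap - ψ.toLinearMap)) (fun x _ y z => ?_) hw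
  change φ _ - ψ _ ∈ (I'.gamma 2).carrier
  rw [φ.map_bracket, φ.map_bracket, ψ.map_bracket, ψ.map_bracket]
  have e : br K (br K (φ x) (φ y)) (φ z) - br K (br K (ψ x) (ψ y)) (ψ z) =
      br K (br K (φ x - ψ x) (φ y)) (φ z) + br K (br K (ψ x) (φ y - ψ y)) (φ z) +
        br K (br K (ψ x) (ψ y)) (φ z - ψ z) := by
    simp only [br_sub, sub_br]
    abel
  rw [e]
  exact add_mem (add_mem (I'.br_br_mem_gamma_two_left (h x) _ _)
    (I'.br_br_mem_gamma_two_mid (h y) _ _)) (I'.br_br_mem_gamma_two_right (h z) _ _)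

end SuperIdeal

/-! ### Commuting subalgebras modulo an ideal -/

section Mixed

open SuperIdeal

variable {K : Type*} [CommRing K] {F F₁ F₂ : Type*} [AddCommGroup F] [Module K F]
  [LieSuperalgebra K F] [AddCommGroup F₁] [Module K F₁] [LieSuperalgebra K F₁]
  [AddCommGroup F₂] [Module K F₂] [LieSuperalgebra K F₂] {R : SuperIdeal K F}
  {i₁ : LieSuperHom K F₁ F} {i₂ : LieSuperHom K F₂ F}

theorem br_swap_mem (hR : ∀ y x, br K (i₂ y) (i₁ x) ∈ R.carrier) (x : F₁) (y : F₂) :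
    br K (i₁ x) (i₂ y) ∈ R.carrier := by
  rw [br_skew, ← i₁.isEven.map_odd, ← i₂.isEven.map_odd]
  exact add_mem (neg_mem (hR _ _)) (Submodule.smul_mem _ _ (hR _ _))

/-- If `[F₂, F₁] ⊆ R` then `[F₂, [F₁, F₁]] ⊆ [R, F]`. -/
theorem br_derived_mem (hR : ∀ y x, br K (i₂ y) (i₁ x) ∈ R.carrier) (y : F₂) {w : F₁}
    (hw : w ∈ ((top K F₁).comm (top K F₁)).carrier) :
    br K (i₂ y) (i₁ w) ∈ (R.comm (top K F)).carrier := by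
  refine comm_le (top K F₁) (S := (R.comm (top K F)).carrier.comap
    (LieSuperalgebra.bracket (K := K) (i₂ y) ∘ₗ i₁.toLinearMap)) (fun x _ x' _ => ?_) hw
  change br K (i₂ y) (i₁ (br K x x')) ∈ (R.comm (top K F)).carrier
  rw [i₁.map_bracket, br_jacobi, ← i₁.isEven.map_odd, ← i₂.isEven.map_odd]
  exact sub_mem (add_mem (R.br_mem_comm (hR _ _) trivial)
    (R.br_mem_comm_swap (hR _ _) trivial))
    (Submodule.smul_mem _ _ (R.br_mem_comm_swap (hR _ _) trivial))

/-- If `[F₂, F₁] ⊆ R` then `[[F₂, F₂], F₁] ⊆ [R, F]`. -/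
theorem derived_br_mem (hR : ∀ y x, br K (i₂ y) (i₁ x) ∈ R.carrier) {w : F₂}
    (hw : w ∈ ((top K F₂).comm (top K F₂)).carrier) (x : F₁) :
    br K (i₂ w) (i₁ x) ∈ (R.comm (top K F)).carrier := by
  have hR' := br_swap_mem hR
  rw [br_skew, ← i₁.isEven.map_odd, ← i₂.isEven.map_odd]
  exact add_mem (neg_mem (br_derived_mem hR' x hw)) (Submodule.smul_mem _ _
    (br_derived_mem hR' _ (((top K F₂).comm (top K F₂)).homogeneous.odd_mem hw)))

theorem exists_factor {N V M : Type*} [AddCommGroup N] [Module K N] [AddCommGroup V] [Module K V]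
    [AddCommGroup M] [Module K M] {q : N →ₗ[K] V} (hq : Function.Surjective q) {f : N →ₗ[K] M}
    (h : ∀ n, q n = 0 → f n = 0) : ∃ g : V →ₗ[K] M, ∀ n, g (q n) = f n := by
  refine ⟨(LinearMap.ker q).liftQ f h ∘ₗ (q.quotKerEquivOfSurjective hq).symm, fun n => ?_⟩
  have : (q.quotKerEquivOfSurjective hq).symm (q n) = (LinearMap.ker q).mkQ n :=
    (LinearEquiv.symm_apply_eq _).2 rfl
  rw [LinearMap.comp_apply, LinearEquiv.coe_coe, this]
  rfl

/-- A trilinear map which vanishes on the kernels of given surjections factors through the tensor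
product of their targets. -/
theorem exists_factor_tensor {N₁ N₂ V₁ V₂ M : Type*} [AddCommGroup N₁] [Module K N₁]
    [AddCommGroup N₂] [Module K N₂] [AddCommGroup V₁] [Module K V₁] [AddCommGroup V₂] [Module K V₂]
    [AddCommGroup M] [Module K M] {q₁ : N₁ →ₗ[K] V₁} (hq₁ : Function.Surjective q₁)
    {q₂ : N₂ →ₗ[K] V₂} (hq₂ : Function.Surjective q₂) (B : N₂ →ₗ[K] N₁ →ₗ[K] N₁ →ₗ[K] M)
    (h₂ : ∀ y, q₂ y = 0 → ∀ x x', B y x x' = 0) (h₁ : ∀ x, q₁ x = 0 → ∀ y x', B y x x' = 0)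
    (h₁' : ∀ x', q₁ x' = 0 → ∀ y x, B y x x' = 0) :
    ∃ Ψ : (V₂ ⊗[K] V₁) ⊗[K] V₁ →ₗ[K] M, ∀ y x x', Ψ ((q₂ y ⊗ₜ q₁ x) ⊗ₜ q₁ x') = B y x x' := by
  obtain ⟨f, hf⟩ := exists_factor hq₂ (f := B) fun y hy =>
    LinearMap.ext fun x => LinearMap.ext fun x' => h₂ y hy x x'
  obtain ⟨g, hg⟩ := exists_factor hq₁ (f := f.flip) fun x hx => LinearMap.ext fun v => by
    obtain ⟨y, rfl⟩ := hq₂ v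
    exact LinearMap.ext fun x' => by rw [LinearMap.flip_apply, hf]; exact h₁ x hx y x'
  have hg' : ∀ x y, g (q₁ x) (q₂ y) = B y x := fun x y => by rw [hg, LinearMap.flip_apply, hf]
  obtain ⟨k, hk⟩ := exists_factor hq₁ (f := (TensorProduct.lift g.flip).flip) fun x' hx' => by
    refine TensorProduct.ext' fun v u => ?_
    obtain ⟨y, rfl⟩ := hq₂ v
    obtain ⟨x, rfl⟩ := hq₁ u
    rw [LinearMap.flip_apply, TensorProduct.lift.tmul, LinearMap.flip_apply, hg']
    exact h₁' x' hx' y x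
  refine ⟨TensorProduct.lift k.flip, fun y x x' => ?_⟩
  rw [TensorProduct.lift.tmul, LinearMap.flip_apply, hk, LinearMap.flip_apply,
    TensorProduct.lift.tmul, LinearMap.flip_apply, hg']

variable {V₁ V₂ : Type*} [AddCommGroup V₁] [Module K V₁] [AddCommGroup V₂] [Module K V₂]

/-- If `[F₂, F₁] ⊆ R`, the class of `[[y, x], x']` modulo `γ₃(R, F)` depends only on the classes
of `y`, `x`, `x'` modulo `R` and derived subalgebras. -/
theorem exists_tensor_map {q₁ : F₁ →ₗ[K] V₁} (hq₁ : Function.Surjective q₁)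
    {q₂ : F₂ →ₗ[K] V₂} (hq₂ : Function.Surjective q₂)
    (hR : ∀ y x, br K (i₂ y) (i₁ x) ∈ R.carrier)
    (h₁ : ∀ x, q₁ x = 0 →
      ∃ w ∈ ((top K F₁).comm (top K F₁)).carrier, i₁ x - i₁ w ∈ R.carrier)
    (h₂ : ∀ y, q₂ y = 0 →
      ∃ w ∈ ((top K F₂).comm (top K F₂)).carrier, i₂ y - i₂ w ∈ R.carrier) :
    ∃ Ψ : (V₂ ⊗[K] V₁) ⊗[K] V₁ →ₗ[K] F ⧸ (R.gamma 2).carrier, ∀ y x x',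
      Ψ ((q₂ y ⊗ₜ q₁ x) ⊗ₜ q₁ x') =
        (R.gamma 2).carrier.mkQ (br K (br K (i₂ y) (i₁ x)) (i₁ x')) := by
  let β : F →ₗ[K] F →ₗ[K] F := LieSuperalgebra.bracket
  -- `B y x x'` is the class of `[[y, x], x']`.
  let c : (F →ₗ[K] F) →ₗ[K] (F₁ →ₗ[K] F ⧸ (R.gamma 2).carrier) :=
    LinearMap.lcomp K _ i₁.toLinearMap ∘ₗ LinearMap.compRight K (R.gamma 2).carrier.mkQ
  let B := (β.compr₂ (c ∘ₗ β)).compl₁₂ i₂.toLinearMap i₁.toLinearMap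
  have hB : ∀ y x x', br K (br K (i₂ y) (i₁ x)) (i₁ x') ∈ (R.gamma 2).carrier → B y x x' = 0 :=
    fun y x x' h => (Submodule.Quotient.mk_eq_zero _).2 h
  refine exists_factor_tensor hq₁ hq₂ B (fun y hy x x' => hB y x x' ?_)
    (fun x hx y x' => hB y x x' ?_) (fun x' hx' y x => hB y x x' ?_)
  · obtain ⟨w, hw, h⟩ := h₂ y hy
    rw [← sub_add_cancel (i₂ y) (i₂ w), add_br, add_br]
    exact add_mem (R.br_br_mem_gamma_two_left h _ _)
      (br_mem_comm _ (derived_br_mem hR hw x) trivial)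
  · obtain ⟨w, hw, h⟩ := h₁ x hx
    rw [← sub_add_cancel (i₁ x) (i₁ w), br_add, add_br]
    exact add_mem (R.br_br_mem_gamma_two_mid h _ _)
      (br_mem_comm _ (br_derived_mem hR y hw) trivial)
  · obtain ⟨w, hw, h⟩ := h₁ x' hx'
    rw [← sub_add_cancel (i₁ x') (i₁ w), br_add]
    refine add_mem (R.br_br_mem_gamma_two_right h _ _) (R.br_mem_gamma_two (hR y x) ?_)
    refine comm_le (top K F₁) (S := ((top K F).comm (top K F)).carrier.comap i₁.toLinearMap)
      (fun a _ b _ => ?_) hw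
    change i₁ _ ∈ ((top K F).comm (top K F)).carrier
    rw [i₁.map_bracket]
    exact br_mem_comm _ trivial trivial

/-- A submodule which contains the brackets `[[y, x], x']` contains the brackets `[[x, y], x']`. -/
theorem br_br_mem_mid {S : Submodule K F}
    (hS : ∀ y x x', br K (br K (i₂ y) (i₁ x)) (i₁ x') ∈ S) (x x' : F₁) (y : F₂) :
    br K (br K (i₁ x) (i₂ y)) (i₁ x') ∈ S := by
  rw [br_skew (i₁ x), add_br, neg_br, smul_br, ← i₁.isEven.map_odd, ← i₂.isEven.map_odd]
  exact add_mem (neg_mem (hS _ _ _)) (Submodule.smul_mem _ _ (hS _ _ _))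

/-- A submodule which contains the brackets `[[y, x], x']` contains the brackets `[[x, x'], y]`:
by the Jacobi identity, `[y, [x, x']]` is a combination of brackets of the first kind. -/
theorem br_br_mem_right {S : Submodule K F}
    (hS : ∀ y x x', br K (br K (i₂ y) (i₁ x)) (i₁ x') ∈ S) (x x' : F₁) (y : F₂) :
    br K (br K (i₁ x) (i₁ x')) (i₂ y) ∈ S := by
  -- The odd component of `[y, x']` is a combination of brackets of elements of `F₂` and `F₁`.
  have h1 : ∀ x y x', br K (i₁ x) (br K (i₂ y) (i₁ x')) ∈ S := by
    intro x y x'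
    rw [br_skew, odd_br]
    simp only [sub_br, add_br, smul_br, ← i₁.isEven.map_odd, ← i₂.isEven.map_odd]
    exact add_mem (neg_mem (hS _ _ _)) (Submodule.smul_mem _ _
      (sub_mem (add_mem (hS _ _ _) (hS _ _ _)) (Submodule.smul_mem _ _ (hS _ _ _))))
  have h2 : ∀ y x x', br K (i₂ y) (br K (i₁ x) (i₁ x')) ∈ S := by
    intro y x x'
    rw [br_jacobi, ← i₁.isEven.map_odd, ← i₂.isEven.map_odd]
    exact sub_mem (add_mem (hS _ _ _) (h1 _ _ _)) (Submodule.smul_mem _ _ (h1 _ _ _))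
  rw [br_skew, odd_br]
  simp only [br_sub, br_add, br_smul, ← i₁.isEven.map_odd, ← i₂.isEven.map_odd]
  exact add_mem (neg_mem (h2 _ _ _)) (Submodule.smul_mem _ _
    (sub_mem (add_mem (h2 _ _ _) (h2 _ _ _)) (Submodule.smul_mem _ _ (h2 _ _ _))))

/-- If `F = F₁ + F₂ + R`, then `γ₃(F)` is spanned modulo `γ₃(R, F)` by `γ₃(F₁)`, `γ₃(F₂)` and
the brackets `[[F₂, F₁], F₁]` and `[[F₁, F₂], F₂]`. -/
theorem gamma_two_top_le (hF : ∀ f, ∃ a b, f - (i₁ a + i₂ b) ∈ R.carrier) {S : Submodule K F}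
    (hS : (R.gamma 2).carrier ≤ S)
    (h₁ : ∀ w ∈ ((top K F₁).gamma 2).carrier, i₁ w ∈ S)
    (h₂ : ∀ w ∈ ((top K F₂).gamma 2).carrier, i₂ w ∈ S)
    (h₂₁ : ∀ y x x', br K (br K (i₂ y) (i₁ x)) (i₁ x') ∈ S)
    (h₁₂ : ∀ x y y', br K (br K (i₁ x) (i₂ y)) (i₂ y') ∈ S) :
    ((top K F).gamma 2).carrier ≤ S := by
  have ind : ∀ p : F → Prop, (∀ x y, p x → p y → p (x + y)) → (∀ a, p (i₁ a)) →
      (∀ b, p (i₂ b)) → (∀ r ∈ R.carrier, p r) → ∀ f, p f := by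
    intro p hp ha hb hr f
    obtain ⟨a, b, h⟩ := hF f
    rw [← sub_add_cancel f (i₁ a + i₂ b)]
    exact hp _ _ (hr _ h) (hp _ _ (ha a) (hb b))
  have h111 : ∀ a b c, br K (br K (i₁ a) (i₁ b)) (i₁ c) ∈ S := fun a b c => by
    rw [← i₁.map_bracket, ← i₁.map_bracket]
    exact h₁ _ ((top K F₁).br_br_mem_gamma_two_left trivial _ _)
  have h222 : ∀ a b c, br K (br K (i₂ a) (i₂ b)) (i₂ c) ∈ S := fun a b c => by
    rw [← i₂.map_bracket, ← i₂.map_bracket]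
    exact h₂ _ ((top K F₂).br_br_mem_gamma_two_left trivial _ _)
  -- Each of the three slots is split; a slot in `R` puts the bracket into `γ₃(R, F)`.
  refine (top K F).gamma_two_le fun f _ g h => ?_
  refine ind (fun f => br K (br K f g) h ∈ S) (fun x y hx hy => ?_) (fun a => ?_) (fun a => ?_)
    (fun r hr => hS (R.br_br_mem_gamma_two_left hr g h)) f
  · rw [add_br, add_br]; exact add_mem hx hy
  all_goals
    refine ind (fun g => br K (br K _ g) h ∈ S) (fun x y hx hy => ?_) (fun b => ?_) (fun b => ?_)
      (fun r hr => hS (R.br_br_mem_gamma_two_mid hr _ h)) g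
    · rw [br_add, add_br]; exact add_mem hx hy
  all_goals
    refine ind (fun h => br K (br K _ _) h ∈ S) (fun x y hx hy => ?_) (fun c => ?_) (fun c => ?_)
      (fun r hr => hS (R.br_br_mem_gamma_two_right hr _ _)) h
    · rw [br_add]; exact add_mem hx hy
  · exact h111 a b c
  · exact br_br_mem_right h₂₁ a b c
  · exact br_br_mem_mid h₂₁ a c b
  · exact h₁₂ a b c
  · exact h₂₁ a b c
  · exact br_br_mem_mid h₁₂ a c b
  · exact br_br_mem_right h₁₂ a b c
  · exact h222 a b c

end Mixed

/-! ### Maps out of `F / γ₃(R, F)` -/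

section Split

open SuperIdeal

variable {K : Type*} [CommRing K] {F F₁ F₂ : Type*} [AddCommGroup F] [Module K F]
  [LieSuperalgebra K F] [AddCommGroup F₁] [Module K F₁] [LieSuperalgebra K F₁]
  [AddCommGroup F₂] [Module K F₂] [LieSuperalgebra K F₂]

/-- The map `F / γ₃(R, F) → F₁ / γ₃(R₁, F₁)` induced by `j`, when `j ∘ i₁` is the identity and
`j ∘ i₂` is zero modulo `R₁`: it inverts `i₁` on the classes of `γ₃(F₁)` and kills those of
`γ₃(F₂)` and the mixed brackets. -/
theorem exists_retraction {R : SuperIdeal K F} {R₁ : SuperIdeal K F₁}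
    {i₁ : LieSuperHom K F₁ F} {i₂ : LieSuperHom K F₂ F} (j : LieSuperHom K F F₁)
    (hj : ∀ r ∈ R.carrier, j r ∈ R₁.carrier) (h₁ : ∀ a, j (i₁ a) - a ∈ R₁.carrier)
    (h₂ : ∀ b, j (i₂ b) ∈ R₁.carrier) :
    ∃ J : F ⧸ (R.gamma 2).carrier →ₗ[K] F₁ ⧸ (R₁.gamma 2).carrier,
      (∀ w, J ((R.gamma 2).carrier.mkQ w) = (R₁.gamma 2).carrier.mkQ (j w)) ∧
      (∀ u ∈ ((top K F₁).gamma 2).carrier,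
        J ((R.gamma 2).carrier.mkQ (i₁ u)) = (R₁.gamma 2).carrier.mkQ u) ∧
      (∀ u ∈ ((top K F₂).gamma 2).carrier, J ((R.gamma 2).carrier.mkQ (i₂ u)) = 0) ∧
      (∀ y x x', J ((R.gamma 2).carrier.mkQ (br K (br K (i₂ y) (i₁ x)) (i₁ x'))) = 0) ∧
      ∀ x y y', J ((R.gamma 2).carrier.mkQ (br K (br K (i₁ x) (i₂ y)) (i₂ y'))) = 0 := by
  have h0 : ∀ {w}, w ∈ (R₁.gamma 2).carrier → (R₁.gamma 2).carrier.mkQ w = 0 :=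
    fun h => (Submodule.Quotient.mk_eq_zero _).2 h
  refine ⟨(R.gamma 2).carrier.mapQ _ j.toLinearMap fun w hw => map_mem_gamma_two j hj hw,
    fun w => rfl, fun u hu => ?_, fun u hu => ?_, fun y x x' => ?_, fun x y y' => ?_⟩
  · exact (Submodule.Quotient.eq _).2
      (map_sub_map_mem_gamma_two (j.comp i₁) (LieSuperHom.id K F₁) h₁ hu)
  · refine h0 ?_
    refine (top K F₂).gamma_two_le
      (S := (R₁.gamma 2).carrier.comap (j.comp i₂).toLinearMap) (fun x _ y z => ?_) hu
    change j.comp i₂ _ ∈ (R₁.gamma 2).carrier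
    rw [LieSuperHom.map_bracket, LieSuperHom.map_bracket]
    exact R₁.br_br_mem_gamma_two_left (h₂ x) _ _
  · refine h0 ?_
    rw [j.map_bracket, j.map_bracket]
    exact R₁.br_br_mem_gamma_two_left (h₂ y) _ _
  · refine h0 ?_
    rw [j.map_bracket, j.map_bracket]
    exact R₁.br_br_mem_gamma_two_mid (h₂ y) _ _

/-- The projection of `F / γ₃(R, F)` onto `V₂ ⊗ V₁ ⊗ V₁`, which reads off a component of the cubic
part in the tensor algebra of `V₁ ⊕ V₂`. -/
theorem exists_tensor_projection {X : Type*} {deg : X → ZMod 2}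
    {R : SuperIdeal K (FreeLieSuperalgebra K deg)}
    {i₁ : LieSuperHom K F₁ (FreeLieSuperalgebra K deg)}
    {i₂ : LieSuperHom K F₂ (FreeLieSuperalgebra K deg)}
    {V₁ V₂ : Type*} [AddCommGroup V₁] [Module K V₁] [SuperModule K V₁] [AddCommGroup V₂]
    [Module K V₂] [SuperModule K V₂] {q₁ : F₁ →ₗ[K] V₁} {q₂ : F₂ →ₗ[K] V₂}
    {v₁ : FreeLieSuperalgebra K deg →ₗ[K] V₁} {v₂ : FreeLieSuperalgebra K deg →ₗ[K] V₂}
    (hv₁ : IsEven v₁) (hv₂ : IsEven v₂) (hbr₁ : ∀ a b, v₁ (br K a b) = 0)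
    (hbr₂ : ∀ a b, v₂ (br K a b) = 0) (hR₁ : ∀ r ∈ R.carrier, v₁ r = 0)
    (hR₂ : ∀ r ∈ R.carrier, v₂ r = 0) (h₁₁ : ∀ a, v₁ (i₁ a) = q₁ a) (h₁₂ : ∀ b, v₁ (i₂ b) = 0)
    (h₂₁ : ∀ a, v₂ (i₁ a) = 0) (h₂₂ : ∀ b, v₂ (i₂ b) = q₂ b) :
    ∃ Θ : FreeLieSuperalgebra K deg ⧸ (R.gamma 2).carrier →ₗ[K] (V₂ ⊗[K] V₁) ⊗[K] V₁,
      IsEven (Θ ∘ₗ (R.gamma 2).carrier.mkQ) ∧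
      (∀ u ∈ ((top K F₁).gamma 2).carrier, Θ ((R.gamma 2).carrier.mkQ (i₁ u)) = 0) ∧
      (∀ u ∈ ((top K F₂).gamma 2).carrier, Θ ((R.gamma 2).carrier.mkQ (i₂ u)) = 0) ∧
      (∀ y x x', Θ ((R.gamma 2).carrier.mkQ (br K (br K (i₂ y) (i₁ x)) (i₁ x'))) =
        (q₂ y ⊗ₜ q₁ x) ⊗ₜ q₁ x') ∧
      ∀ x y y', Θ ((R.gamma 2).carrier.mkQ (br K (br K (i₁ x) (i₂ y)) (i₂ y'))) = 0 := by
  obtain ⟨τ, hτ, hτbr⟩ := exists_cubic (v₁.prod v₂) (fun i x hx =>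
    show _ ∧ _ from ⟨hv₁ i x hx, hv₂ i x hx⟩)
    (fun a b => Prod.ext (hbr₁ a b) (hbr₂ a b))
  let s := LinearMap.snd K V₁ V₂
  let t := LinearMap.fst K V₁ V₂
  have hs : IsEven s := isEven_snd
  have ht : IsEven t := isEven_fst
  let p := TensorProduct.map (TensorProduct.map s t) t
  have hleft : ∀ a b c, v₂ b = 0 → v₂ c = 0 →
      p (τ (br K (br K a b) c)) = (v₂ a ⊗ₜ v₁ b) ⊗ₜ v₁ c := fun a b c hb hc => by
    rw [hτbr]
    exact TruncatedTensor.map_tripleBracket hs _ hb hc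
  have hzero : ∀ a b c, v₁ b = 0 → v₁ c = 0 → p (τ (br K (br K a b) c)) = 0 :=
    fun a b c hb hc => by
      rw [hτbr]
      exact TruncatedTensor.map_tripleBracket_eq_zero ht _ hb hc
  refine ⟨(R.gamma 2).carrier.liftQ (p ∘ₗ τ) ?_, ((hs.tensorMap ht).tensorMap ht).comp hτ,
    fun u hu => ?_, fun u hu => ?_, fun y x x' => ?_, fun x y y' => ?_⟩
  · refine R.gamma_two_le fun r hr y z => ?_
    have : v₁.prod v₂ r = 0 := Prod.ext (hR₁ r hr) (hR₂ r hr)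
    change p (τ _) = 0
    rw [hτbr, this, TruncatedTensor.tripleBracket_zero_left, map_zero]
  · refine (top K F₁).gamma_two_le (S := LinearMap.ker (p ∘ₗ τ ∘ₗ i₁.toLinearMap))
      (fun x _ y z => ?_) hu
    change p (τ (i₁ _)) = 0
    rw [i₁.map_bracket, i₁.map_bracket, hleft _ _ _ (h₂₁ _) (h₂₁ _), h₂₁]
    simp
  · refine (top K F₂).gamma_two_le (S := LinearMap.ker (p ∘ₗ τ ∘ₗ i₂.toLinearMap))
      (fun x _ y z => ?_) hu
    change p (τ (i₂ _)) = 0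
    rw [i₂.map_bracket, i₂.map_bracket, hzero _ _ _ (h₁₂ _) (h₁₂ _)]
  · change p (τ _) = _
    rw [hleft _ _ _ (h₂₁ _) (h₂₁ _), h₂₂, h₁₁, h₁₁]
  · exact hzero _ _ _ (h₁₂ _) (h₁₂ _)

theorem tensor_ext_of_surjective {N₁ N₂ V₁ V₂ M : Type*} [AddCommGroup N₁] [Module K N₁]
    [AddCommGroup N₂] [Module K N₂] [AddCommGroup V₁] [Module K V₁] [AddCommGroup V₂] [Module K V₂]
    [AddCommGroup M] [Module K M] {q₁ : N₁ →ₗ[K] V₁} (hq₁ : Function.Surjective q₁)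
    {q₂ : N₂ →ₗ[K] V₂} (hq₂ : Function.Surjective q₂) {f g : (V₂ ⊗[K] V₁) ⊗[K] V₁ →ₗ[K] M}
    (h : ∀ y x x', f ((q₂ y ⊗ₜ q₁ x) ⊗ₜ q₁ x') = g ((q₂ y ⊗ₜ q₁ x) ⊗ₜ q₁ x')) : f = g := by
  refine TensorProduct.ext_threefold fun y x x' => ?_
  obtain ⟨y, rfl⟩ := hq₂ y
  obtain ⟨x, rfl⟩ := hq₁ x
  obtain ⟨x', rfl⟩ := hq₁ x'
  exact h y x x'

/-- A criterion for four maps `J₁`, `J₂`, `Θ₁`, `Θ₂` out of `Q` to split a submodule `M` of `Q` into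
a direct sum: `M` is the sum of four pieces, the first two contained in `A₁` and `A₂` and the others
parametrized by `Ψ₁` and `Ψ₂`, and each of the four maps is injective on the corresponding piece
and kills the three others. -/
theorem bijective_of_decomposition {M M₁ M₂ Q Q₁ Q₂ T₁ T₂ : Type*} [AddCommGroup M] [Module K M]
    [AddCommGroup M₁] [Module K M₁] [AddCommGroup M₂] [Module K M₂] [AddCommGroup Q] [Module K Q]
    [AddCommGroup Q₁] [Module K Q₁] [AddCommGroup Q₂] [Module K Q₂] [AddCommGroup T₁] [Module K T₁]
    [AddCommGroup T₂] [Module K T₂] {ι : M →ₗ[K] Q} (hι : Function.Injective ι)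
    {ι₁ : M₁ →ₗ[K] Q₁} (hι₁ : Function.Injective ι₁) {ι₂ : M₂ →ₗ[K] Q₂}
    (hι₂ : Function.Injective ι₂) {f₁ : M →ₗ[K] M₁} {f₂ : M →ₗ[K] M₂} {J₁ : Q →ₗ[K] Q₁}
    {J₂ : Q →ₗ[K] Q₂} (hf₁ : ∀ m, ι₁ (f₁ m) = J₁ (ι m)) (hf₂ : ∀ m, ι₂ (f₂ m) = J₂ (ι m))
    {Θ₁ : Q →ₗ[K] T₁} {Θ₂ : Q →ₗ[K] T₂} {Ψ₁ : T₁ →ₗ[K] Q} {Ψ₂ : T₂ →ₗ[K] Q} {A₁ A₂ : Submodule K Q}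
    (hA₁ : ∀ a ∈ A₁, (J₁ a = 0 → a = 0) ∧ J₂ a = 0 ∧ Θ₁ a = 0 ∧ Θ₂ a = 0)
    (hA₂ : ∀ a ∈ A₂, J₁ a = 0 ∧ (J₂ a = 0 → a = 0) ∧ Θ₁ a = 0 ∧ Θ₂ a = 0)
    (hΨ₁ : ∀ t, J₁ (Ψ₁ t) = 0 ∧ J₂ (Ψ₁ t) = 0 ∧ Θ₁ (Ψ₁ t) = t ∧ Θ₂ (Ψ₁ t) = 0)
    (hΨ₂ : ∀ t, J₁ (Ψ₂ t) = 0 ∧ J₂ (Ψ₂ t) = 0 ∧ Θ₁ (Ψ₂ t) = 0 ∧ Θ₂ (Ψ₂ t) = t)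
    (hM : ∀ m, ∃ a₁ ∈ A₁, ∃ a₂ ∈ A₂, ∃ t₁ t₂, ι m = a₁ + a₂ + Ψ₁ t₁ + Ψ₂ t₂)
    (hM₁ : ∀ m₁, ∃ m, ι m ∈ A₁ ∧ J₁ (ι m) = ι₁ m₁) (hM₂ : ∀ m₂, ∃ m, ι m ∈ A₂ ∧ J₂ (ι m) = ι₂ m₂)
    (hT₁ : ∀ t, ∃ m, ι m = Ψ₁ t) (hT₂ : ∀ t, ∃ m, ι m = Ψ₂ t) :
    Function.Bijective (f₁.prod (f₂.prod ((Θ₁ ∘ₗ ι).prod (Θ₂ ∘ₗ ι)))) := by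
  constructor
  · refine (injective_iff_map_eq_zero _).2 fun m hm => hι ?_
    have h₁ : J₁ (ι m) = 0 := by
      rw [← hf₁, show f₁ m = 0 from congrArg Prod.fst hm, map_zero]
    have h₂ : J₂ (ι m) = 0 := by
      rw [← hf₂, show f₂ m = 0 from congrArg (fun x => x.2.1) hm, map_zero]
    have h₃ : Θ₁ (ι m) = 0 := congrArg (fun x => x.2.2.1) hm
    have h₄ : Θ₂ (ι m) = 0 := congrArg (fun x => x.2.2.2) hm
    obtain ⟨a₁, ha₁, a₂, ha₂, t₁, t₂, e⟩ := hM m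
    simp only [e, map_add, hA₁ a₁ ha₁, hA₂ a₂ ha₂, hΨ₁, hΨ₂, add_zero, zero_add] at h₁ h₂ h₃ h₄
    rw [e, (hA₁ a₁ ha₁).1 h₁, (hA₂ a₂ ha₂).2.1 h₂, h₃, h₄]
    simp
  · rintro ⟨m₁, m₂, t₁, t₂⟩
    obtain ⟨a₁, ha₁, e₁⟩ := hM₁ m₁
    obtain ⟨a₂, ha₂, e₂⟩ := hM₂ m₂
    obtain ⟨b₁, e₃⟩ := hT₁ t₁
    obtain ⟨b₂, e₄⟩ := hT₂ t₂
    refine ⟨a₁ + a₂ + b₁ + b₂, Prod.ext (hι₁ ?_) (Prod.ext (hι₂ ?_) (Prod.ext ?_ ?_))⟩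
    · change ι₁ (f₁ _) = ι₁ m₁
      simp [hf₁, e₁, e₃, e₄, hA₂ _ ha₂, hΨ₁, hΨ₂]
    · change ι₂ (f₂ _) = ι₂ m₂
      simp [hf₂, e₂, e₃, e₄, hA₁ _ ha₁, hΨ₁, hΨ₂]
    · change Θ₁ (ι _) = t₁
      simp [e₃, e₄, hA₁ _ ha₁, hA₂ _ ha₂, hΨ₁, hΨ₂]
    · change Θ₂ (ι _) = t₂
      simp [e₃, e₄, hA₁ _ ha₁, hA₂ _ ha₂, hΨ₁, hΨ₂]

end Split

/-! ### The multiplier -/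

namespace FreePresentation

universe u v w

variable {K : Type u} {L : Type v} [CommRing K] [AddCommGroup L] [Module K L]
  [LieSuperalgebra K L] (P : FreePresentation.{u, v, w} K L)

/-- The class in the multiplier of an element of `R ∩ γ₃(F)`. -/
noncomputable def cls (a : P.F) (ha : a ∈ (P.numerator 2).carrier) : P.multiplier 2 :=
  ((P.R.gamma 2).restrict (P.numerator 2)).proj ⟨a, ha⟩

theorem exists_cls (m : P.multiplier 2) : ∃ a ha, P.cls a ha = m := by
  obtain ⟨⟨a, ha⟩, rfl⟩ := ((P.R.gamma 2).restrict (P.numerator 2)).proj_surjective m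
  exact ⟨a, ha, rfl⟩

theorem exists_cls_of_mem_part {i : ZMod 2} {m : P.multiplier 2}
    (hm : m ∈ part K (P.multiplier 2) i) : ∃ a ha, a ∈ part K P.F i ∧ P.cls a ha = m := by
  obtain ⟨⟨a, ha⟩, hi, rfl⟩ := hm
  exact ⟨a, ha, hi, rfl⟩

theorem cls_eq_zero {a : P.F} {ha : a ∈ (P.numerator 2).carrier}
    (h : a ∈ (P.R.gamma 2).carrier) : P.cls a ha = 0 :=
  (Submodule.Quotient.mk_eq_zero _).2 h

theorem mem_part_of_cls {i : ZMod 2} {a : P.F} {ha : a ∈ (P.numerator 2).carrier}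
    (hi : a ∈ part K P.F i) : P.cls a ha ∈ part K (P.multiplier 2) i :=
  ⟨⟨a, ha⟩, hi, rfl⟩

/-- The multiplier embeds in `F / γ₃(R, F)`. -/
noncomputable def toQuotient : P.multiplier 2 →ₗ[K] P.F ⧸ (P.R.gamma 2).carrier :=
  Submodule.mapQ _ _ (P.numerator 2).incl le_rfl

theorem toQuotient_cls (a : P.F) (ha : a ∈ (P.numerator 2).carrier) :
    P.toQuotient (P.cls a ha) = (P.R.gamma 2).carrier.mkQ a := rfl

theorem toQuotient_injective : Function.Injective P.toQuotient := by
  refine (injective_iff_map_eq_zero _).2 fun m hm => ?_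
  obtain ⟨a, ha, rfl⟩ := P.exists_cls m
  exact P.cls_eq_zero ((Submodule.Quotient.mk_eq_zero _).1 hm)

/-- The multiplier is abelian. -/
theorem multiplier_br (x y : P.multiplier 2) : br K x y = 0 := by
  obtain ⟨a, ha, rfl⟩ := P.exists_cls x
  obtain ⟨b, hb, rfl⟩ := P.exists_cls y
  refine (Submodule.Quotient.mk_eq_zero _).2 ?_
  have hb' : b ∈ ((SuperIdeal.top K P.F).comm (SuperIdeal.top K P.F)).carrier :=
    (SuperIdeal.top K P.F).gamma_two_le
      (fun x _ y z => (SuperIdeal.top K P.F).br_mem_comm (J := SuperIdeal.top K P.F)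
        (x := br K x y) trivial trivial) hb.2
  exact P.R.br_mem_gamma_two ha.1 hb'

variable {P} in
theorem mem_R {a : P.F} : a ∈ P.R.carrier ↔ P.π a = 0 := Iff.rfl

/-- The map of multipliers induced by a homomorphism of presentations. -/
theorem exists_multiplier_map {L' : Type*} [AddCommGroup L'] [Module K L'] [LieSuperalgebra K L']
    {P' : FreePresentation K L'} (φ : LieSuperHom K P.F P'.F)
    (hφ : ∀ r ∈ P.R.carrier, φ r ∈ P'.R.carrier) :
    ∃ f : P.multiplier 2 →ₗ[K] P'.multiplier 2, IsEven f ∧ ∀ a ha,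
      P'.toQuotient (f (P.cls a ha)) = (P'.R.gamma 2).carrier.mkQ (φ a) := by
  have h : ∀ a ∈ (P.numerator 2).carrier, φ a ∈ (P'.numerator 2).carrier := fun a ha =>
    ⟨hφ a ha.1, SuperIdeal.map_mem_gamma_two (I' := SuperIdeal.top K P'.F) φ
    (fun _ _ => trivial) ha.2⟩
  refine ⟨Submodule.mapQ _ _ (φ.toLinearMap.restrict h)
    fun a ha => SuperIdeal.map_mem_gamma_two φ hφ ha, fun i m hm => ?_, fun a ha => rfl⟩
  obtain ⟨a, ha, hi, rfl⟩ := P.exists_cls_of_mem_part hm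
  exact P'.mem_part_of_cls (ha := h a ha) (φ.isEven i a hi)

/-- The map from `F` to the abelianization of `L`. -/
noncomputable def toAb : P.F →ₗ[K] Ab K L :=
  ((SuperIdeal.top K L).comm (SuperIdeal.top K L)).proj ∘ₗ P.π.toLinearMap

theorem toAb_surjective : Function.Surjective P.toAb :=
  (SuperIdeal.proj_surjective _).comp P.surjective

theorem exists_derived_of_toAb_eq_zero {a : P.F} (ha : P.toAb a = 0) :
    ∃ w ∈ ((SuperIdeal.top K P.F).comm (SuperIdeal.top K P.F)).carrier, P.π w = P.π a := by
  have h : P.π a ∈ ((SuperIdeal.top K L).comm (SuperIdeal.top K L)).carrier :=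
    (Submodule.Quotient.mk_eq_zero _).1 ha
  refine SuperIdeal.comm_le (SuperIdeal.top K L) (S :=
    ((SuperIdeal.top K P.F).comm (SuperIdeal.top K P.F)).carrier.map P.π.toLinearMap)
    (fun x _ y _ => ?_) h
  obtain ⟨x, rfl⟩ := P.surjective x
  obtain ⟨y, rfl⟩ := P.surjective y
  exact ⟨br K x y, SuperIdeal.br_mem_comm _ trivial trivial, P.π.map_bracket x y⟩

end FreePresentation

theorem isEven_proj {K L : Type*} [CommRing K] [AddCommGroup L] [Module K L] [LieSuperalgebra K L]
    (I : SuperIdeal K L) : IsEven I.proj := fun _ x hx => ⟨x, hx, rfl⟩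

theorem proj_comm_br {K L : Type*} [CommRing K] [AddCommGroup L] [Module K L]
    [LieSuperalgebra K L] (x y : L) :
    ((SuperIdeal.top K L).comm (SuperIdeal.top K L)).proj (br K x y) = 0 :=
  (Submodule.Quotient.mk_eq_zero _).2 (SuperIdeal.br_mem_comm _ trivial trivial)

end LieSuper

/-! ### The multiplier of a direct sum -/

open LieSuper LieSuper.SuperIdeal LieSuper.FreePresentation

theorem theoremt6 {K : Type*} [CommRing K]
    {L₁ L₂ : Type*} [AddCommGroup L₁] [Module K L₁] [LieSuper.LieSuperalgebra K L₁]
    [AddCommGroup L₂] [Module K L₂] [LieSuper.LieSuperalgebra K L₂]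
    (P₁ : LieSuper.FreePresentation K L₁) (P₂ : LieSuper.FreePresentation K L₂)
    (P : LieSuper.FreePresentation K (L₁ × L₂)) :
    Nonempty (LieSuper.LieSuperEquiv K (P.multiplier 2)
      (P₁.multiplier 2 × P₂.multiplier 2 ×
        LieSuper.AbelianLie
          (TensorProduct K (TensorProduct K (LieSuper.Ab K L₂) (LieSuper.Ab K L₁))
            (LieSuper.Ab K L₁)) ×
        LieSuper.AbelianLie
          (TensorProduct K (TensorProduct K (LieSuper.Ab K L₂) (LieSuper.Ab K L₁))
            (LieSuper.Ab K L₂)))) := by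
  -- Freeness lifts the inclusions and projections of `L₁ × L₂` to the presentations.
  obtain ⟨i₁, hi₁⟩ := exists_hom_lift P.π P.surjective ((LieSuperHom.inl K L₁ L₂).comp P₁.π)
  obtain ⟨i₂, hi₂⟩ := exists_hom_lift P.π P.surjective ((LieSuperHom.inr K L₁ L₂).comp P₂.π)
  obtain ⟨j₁, hj₁⟩ := exists_hom_lift P₁.π P₁.surjective ((LieSuperHom.fst K L₁ L₂).comp P.π)
  obtain ⟨j₂, hj₂⟩ := exists_hom_lift P₂.π P₂.surjective ((LieSuperHom.snd K L₁ L₂).comp P.π)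
  replace hi₁ : ∀ a, P.π (i₁ a) = (P₁.π a, 0) := hi₁
  replace hi₂ : ∀ a, P.π (i₂ a) = (0, P₂.π a) := hi₂
  replace hj₁ : ∀ a, P₁.π (j₁ a) = (P.π a).1 := hj₁
  replace hj₂ : ∀ a, P₂.π (j₂ a) = (P.π a).2 := hj₂
  -- `F = F₁ + F₂ + R`, and `[F₂, F₁] ⊆ R` since `L₁` and `L₂` commute in `L₁ × L₂`.
  have hR₂₁ : ∀ y x, br K (i₂ y) (i₁ x) ∈ P.R.carrier := fun y x => by
    rw [mem_R, P.π.map_bracket, hi₁, hi₂]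
    exact Prod.ext (show br K 0 _ = 0 by simp [br]) (show br K _ 0 = 0 by simp [br])
  have hR₁₂ := br_swap_mem hR₂₁
  have hF : ∀ f, ∃ a b, f - (i₁ a + i₂ b) ∈ P.R.carrier := fun f => by
    obtain ⟨a, ha⟩ := P₁.surjective (P.π f).1
    obtain ⟨b, hb⟩ := P₂.surjective (P.π f).2
    refine ⟨a, b, ?_⟩
    rw [mem_R, map_sub, map_add, hi₁, hi₂, ha, hb]
    simp
  have hker₁ : ∀ x, P₁.toAb x = 0 →
      ∃ w ∈ ((top K P₁.F).comm (top K P₁.F)).carrier, i₁ x - i₁ w ∈ P.R.carrier := fun x hx => by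
    obtain ⟨w, hw, h⟩ := P₁.exists_derived_of_toAb_eq_zero hx
    exact ⟨w, hw, by rw [mem_R, map_sub, hi₁, hi₁, h, sub_self]⟩
  have hker₂ : ∀ x, P₂.toAb x = 0 →
      ∃ w ∈ ((top K P₂.F).comm (top K P₂.F)).carrier, i₂ x - i₂ w ∈ P.R.carrier := fun x hx => by
    obtain ⟨w, hw, h⟩ := P₂.exists_derived_of_toAb_eq_zero hx
    exact ⟨w, hw, by rw [mem_R, map_sub, hi₂, hi₂, h, sub_self]⟩
  -- The mixed brackets modulo `γ₃(R, F)`, as images of the two tensor products.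
  obtain ⟨Ψ₁, hΨ₁⟩ := exists_tensor_map P₁.toAb_surjective P₂.toAb_surjective hR₂₁ hker₁ hker₂
  obtain ⟨Ψ₂, hΨ₂⟩ := exists_tensor_map P₂.toAb_surjective P₁.toAb_surjective hR₁₂ hker₂ hker₁
  -- The maps which detect the first two summands.
  have hj₁R : ∀ r ∈ P.R.carrier, j₁ r ∈ P₁.R.carrier := fun r hr => by
    rw [mem_R, hj₁, mem_R.1 hr, Prod.fst_zero]
  have hj₂R : ∀ r ∈ P.R.carrier, j₂ r ∈ P₂.R.carrier := fun r hr => by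
    rw [mem_R, hj₂, mem_R.1 hr, Prod.snd_zero]
  obtain ⟨J₁, hJ₁, hJ₁₁, hJ₁₂, hJ₁Ψ₁, hJ₁Ψ₂⟩ := exists_retraction (i₁ := i₁) (i₂ := i₂) j₁ hj₁R
    (fun a => by rw [mem_R, map_sub, hj₁, hi₁, sub_self]) (fun b => by rw [mem_R, hj₁, hi₂])
  obtain ⟨J₂, hJ₂, hJ₂₂, hJ₂₁, hJ₂Ψ₂, hJ₂Ψ₁⟩ := exists_retraction (i₁ := i₂) (i₂ := i₁) j₂ hj₂R
    (fun a => by rw [mem_R, map_sub, hj₂, hi₂, sub_self]) (fun b => by rw [mem_R, hj₂, hi₁])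
  -- The maps which detect the last two summands.
  let v₁ : P.F →ₗ[K] Ab K L₁ :=
    ((top K L₁).comm (top K L₁)).proj ∘ₗ LinearMap.fst K L₁ L₂ ∘ₗ P.π.toLinearMap
  let v₂ : P.F →ₗ[K] Ab K L₂ :=
    ((top K L₂).comm (top K L₂)).proj ∘ₗ LinearMap.snd K L₁ L₂ ∘ₗ P.π.toLinearMap
  have hv₁ : IsEven v₁ := (isEven_proj _).comp (isEven_fst.comp P.π.isEven)
  have hv₂ : IsEven v₂ := (isEven_proj _).comp (isEven_snd.comp P.π.isEven)
  have hv₁br : ∀ a b, v₁ (br K a b) = 0 := fun a b =>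
    (congrArg (fun x : L₁ × L₂ => Submodule.Quotient.mk x.1) (P.π.map_bracket a b)).trans
      (proj_comm_br _ _)
  have hv₂br : ∀ a b, v₂ (br K a b) = 0 := fun a b =>
    (congrArg (fun x : L₁ × L₂ => Submodule.Quotient.mk x.2) (P.π.map_bracket a b)).trans
      (proj_comm_br _ _)
  have hv₁R : ∀ r ∈ P.R.carrier, v₁ r = 0 := fun r hr => by
    change proj _ (P.π r).1 = 0
    rw [mem_R.1 hr, Prod.fst_zero, map_zero]
  have hv₂R : ∀ r ∈ P.R.carrier, v₂ r = 0 := fun r hr => by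
    change proj _ (P.π r).2 = 0
    rw [mem_R.1 hr, Prod.snd_zero, map_zero]
  have hv₁₁ : ∀ a, v₁ (i₁ a) = P₁.toAb a := fun a => by
    change proj _ (P.π (i₁ a)).1 = _
    rw [hi₁]; rfl
  have hv₁₂ : ∀ a, v₁ (i₂ a) = 0 := fun a => by
    change proj _ (P.π (i₂ a)).1 = _
    rw [hi₂, map_zero]
  have hv₂₁ : ∀ a, v₂ (i₁ a) = 0 := fun a => by
    change proj _ (P.π (i₁ a)).2 = _
    rw [hi₁, map_zero]
  have hv₂₂ : ∀ a, v₂ (i₂ a) = P₂.toAb a := fun a => by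
    change proj _ (P.π (i₂ a)).2 = _
    rw [hi₂]; rfl
  obtain ⟨Θ₁, hΘ₁, hΘ₁₁, hΘ₁₂, hΘ₁Ψ₁, hΘ₁Ψ₂⟩ := exists_tensor_projection hv₁ hv₂ hv₁br hv₂br
    hv₁R hv₂R hv₁₁ hv₁₂ hv₂₁ hv₂₂
  obtain ⟨Θ₂, hΘ₂, hΘ₂₂, hΘ₂₁, hΘ₂Ψ₂, hΘ₂Ψ₁⟩ := exists_tensor_projection hv₂ hv₁ hv₂br hv₁br
    hv₂R hv₁R hv₂₂ hv₂₁ hv₁₂ hv₁₁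
  -- On the mixed brackets, `Θ₁` and `Θ₂` invert `Ψ₁` and `Ψ₂`, and all other composites vanish.
  have hΘΨ₁ : ∀ t, Θ₁ (Ψ₁ t) = t := LinearMap.congr_fun (g := LinearMap.id)
    (tensor_ext_of_surjective (f := Θ₁ ∘ₗ Ψ₁) P₁.toAb_surjective P₂.toAb_surjective
      fun y x x' => (congrArg Θ₁ (hΨ₁ y x x')).trans (hΘ₁Ψ₁ y x x'))
  have hΘΨ₂ : ∀ t, Θ₂ (Ψ₂ t) = t := LinearMap.congr_fun (g := LinearMap.id)
    (tensor_ext_of_surjective (f := Θ₂ ∘ₗ Ψ₂) P₂.toAb_surjective P₁.toAb_surjective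
      fun y x x' => (congrArg Θ₂ (hΨ₂ y x x')).trans (hΘ₂Ψ₂ y x x'))
  have hΘ₁₀ : ∀ t, Θ₁ (Ψ₂ t) = 0 := LinearMap.congr_fun (g := 0)
    (tensor_ext_of_surjective (f := Θ₁ ∘ₗ Ψ₂) P₂.toAb_surjective P₁.toAb_surjective
      fun y x x' => (congrArg Θ₁ (hΨ₂ y x x')).trans (hΘ₁Ψ₂ y x x'))
  have hΘ₂₀ : ∀ t, Θ₂ (Ψ₁ t) = 0 := LinearMap.congr_fun (g := 0)
    (tensor_ext_of_surjective (f := Θ₂ ∘ₗ Ψ₁) P₁.toAb_surjective P₂.toAb_surjective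
      fun y x x' => (congrArg Θ₂ (hΨ₁ y x x')).trans (hΘ₂Ψ₁ y x x'))
  have hJΨ₁₁ : ∀ t, J₁ (Ψ₁ t) = 0 := LinearMap.congr_fun (g := 0)
    (tensor_ext_of_surjective (f := J₁ ∘ₗ Ψ₁) P₁.toAb_surjective P₂.toAb_surjective
      fun y x x' => (congrArg J₁ (hΨ₁ y x x')).trans (hJ₁Ψ₁ y x x'))
  have hJΨ₁₂ : ∀ t, J₁ (Ψ₂ t) = 0 := LinearMap.congr_fun (g := 0)
    (tensor_ext_of_surjective (f := J₁ ∘ₗ Ψ₂) P₂.toAb_surjective P₁.toAb_surjective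
      fun y x x' => (congrArg J₁ (hΨ₂ y x x')).trans (hJ₁Ψ₂ y x x'))
  have hJΨ₂₁ : ∀ t, J₂ (Ψ₁ t) = 0 := LinearMap.congr_fun (g := 0)
    (tensor_ext_of_surjective (f := J₂ ∘ₗ Ψ₁) P₁.toAb_surjective P₂.toAb_surjective
      fun y x x' => (congrArg J₂ (hΨ₁ y x x')).trans (hJ₂Ψ₁ y x x'))
  have hJΨ₂₂ : ∀ t, J₂ (Ψ₂ t) = 0 := LinearMap.congr_fun (g := 0)
    (tensor_ext_of_surjective (f := J₂ ∘ₗ Ψ₂) P₂.toAb_surjective P₁.toAb_surjective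
      fun y x x' => (congrArg J₂ (hΨ₂ y x x')).trans (hJ₂Ψ₂ y x x'))
  have hi₁R : ∀ r ∈ P₁.R.carrier, i₁ r ∈ P.R.carrier := fun r hr => by
    rw [mem_R, hi₁, mem_R.1 hr]; rfl
  have hi₂R : ∀ r ∈ P₂.R.carrier, i₂ r ∈ P.R.carrier := fun r hr => by
    rw [mem_R, hi₂, mem_R.1 hr]; rfl
  -- Restriction from `F / γ₃(R, F)` to the multiplier.
  obtain ⟨f₁, hf₁, hf₁cls⟩ := P.exists_multiplier_map (P' := P₁) j₁ hj₁R
  obtain ⟨f₂, hf₂, hf₂cls⟩ := P.exists_multiplier_map (P' := P₂) j₂ hj₂R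
  have hf₁J : ∀ m, P₁.toQuotient (f₁ m) = J₁ (P.toQuotient m) := fun m => by
    obtain ⟨a, ha, rfl⟩ := P.exists_cls m
    rw [hf₁cls, toQuotient_cls, hJ₁]
  have hf₂J : ∀ m, P₂.toQuotient (f₂ m) = J₂ (P.toQuotient m) := fun m => by
    obtain ⟨a, ha, rfl⟩ := P.exists_cls m
    rw [hf₂cls, toQuotient_cls, hJ₂]
  have hrange₁ : ∀ t, ∃ m, P.toQuotient m = Ψ₁ t := by
    have h := tensor_ext_of_surjective P₁.toAb_surjective P₂.toAb_surjective
      (f := (LinearMap.range P.toQuotient).mkQ ∘ₗ Ψ₁) (g := 0) fun y x x' =>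
        (Submodule.Quotient.mk_eq_zero _).2 (hΨ₁ y x x' ▸ ⟨P.cls _
          ⟨P.R.br_mem_right (hR₂₁ y x) _, br_br_mem_gamma_two_left (top K P.F) trivial _ _⟩, rfl⟩)
    exact fun t => (Submodule.Quotient.mk_eq_zero _).1 (LinearMap.congr_fun h t)
  have hrange₂ : ∀ t, ∃ m, P.toQuotient m = Ψ₂ t := by
    have h := tensor_ext_of_surjective P₂.toAb_surjective P₁.toAb_surjective
      (f := (LinearMap.range P.toQuotient).mkQ ∘ₗ Ψ₂) (g := 0) fun y x x' =>
        (Submodule.Quotient.mk_eq_zero _).2 (hΨ₂ y x x' ▸ ⟨P.cls _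
          ⟨P.R.br_mem_right (hR₁₂ y x) _, br_br_mem_gamma_two_left (top K P.F) trivial _ _⟩, rfl⟩)
    exact fun t => (Submodule.Quotient.mk_eq_zero _).1 (LinearMap.congr_fun h t)
  have hκ : ∀ {w}, w ∈ (P.R.gamma 2).carrier → (P.R.gamma 2).carrier.mkQ w = 0 :=
    fun h => (Submodule.Quotient.mk_eq_zero _).2 h
  let A₁ := ((top K P₁.F).gamma 2).carrier.map ((P.R.gamma 2).carrier.mkQ ∘ₗ i₁.toLinearMap)
  let A₂ := ((top K P₂.F).gamma 2).carrier.map ((P.R.gamma 2).carrier.mkQ ∘ₗ i₂.toLinearMap)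
  have bij := bijective_of_decomposition (A₁ := A₁) (A₂ := A₂) P.toQuotient_injective
    P₁.toQuotient_injective P₂.toQuotient_injective hf₁J hf₂J
    (by
      rintro _ ⟨u, hu, rfl⟩
      refine ⟨fun h => ?_, hJ₂₁ u hu, hΘ₁₁ u hu, hΘ₂₁ u hu⟩
      exact hκ (map_mem_gamma_two i₁ hi₁R
        ((Submodule.Quotient.mk_eq_zero _).1 ((hJ₁₁ u hu).symm.trans h))))
    (by
      rintro _ ⟨u, hu, rfl⟩
      refine ⟨hJ₁₂ u hu, fun h => ?_, hΘ₁₂ u hu, hΘ₂₂ u hu⟩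
      exact hκ (map_mem_gamma_two i₂ hi₂R
        ((Submodule.Quotient.mk_eq_zero _).1 ((hJ₂₂ u hu).symm.trans h))))
    (fun t => ⟨hJΨ₁₁ t, hJΨ₂₁ t, hΘΨ₁ t, hΘ₂₀ t⟩) (fun t => ⟨hJΨ₁₂ t, hJΨ₂₂ t, hΘ₁₀ t, hΘΨ₂ t⟩)
    (by
      intro m
      obtain ⟨w, hw, rfl⟩ := P.exists_cls m
      have h := gamma_two_top_le hF (S := (((A₁ ⊔ A₂) ⊔ LinearMap.range Ψ₁) ⊔
        LinearMap.range Ψ₂).comap (P.R.gamma 2).carrier.mkQ)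
        (fun r hr => by rw [Submodule.mem_comap, hκ hr]; exact zero_mem _)
        (fun u hu => Submodule.mem_sup_left (Submodule.mem_sup_left
          (Submodule.mem_sup_left ⟨u, hu, rfl⟩)))
        (fun u hu => Submodule.mem_sup_left (Submodule.mem_sup_left
          (Submodule.mem_sup_right ⟨u, hu, rfl⟩)))
        (fun y x x' => Submodule.mem_sup_left (Submodule.mem_sup_right ⟨_, hΨ₁ y x x'⟩))
        (fun x y y' => Submodule.mem_sup_right ⟨_, hΨ₂ x y y'⟩) hw.2
      obtain ⟨_, h, _, ⟨t₂, rfl⟩, e₁⟩ := Submodule.mem_sup.1 h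
      obtain ⟨_, h, _, ⟨t₁, rfl⟩, e₂⟩ := Submodule.mem_sup.1 h
      obtain ⟨a₁, ha₁, a₂, ha₂, e₃⟩ := Submodule.mem_sup.1 h
      exact ⟨a₁, ha₁, a₂, ha₂, t₁, t₂, by rw [toQuotient_cls, ← e₁, ← e₂, ← e₃]⟩)
    (fun m => by
      obtain ⟨u, hu, rfl⟩ := P₁.exists_cls m
      exact ⟨P.cls (i₁ u) ⟨hi₁R u hu.1, map_mem_gamma_two (I' := top K P.F) i₁
        (fun _ _ => trivial) hu.2⟩, ⟨u, hu.2, rfl⟩, hJ₁₁ u hu.2⟩)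
    (fun m => by
      obtain ⟨u, hu, rfl⟩ := P₂.exists_cls m
      exact ⟨P.cls (i₂ u) ⟨hi₂R u hu.1, map_mem_gamma_two (I' := top K P.F) i₂
        (fun _ _ => trivial) hu.2⟩, ⟨u, hu.2, rfl⟩, hJ₂₂ u hu.2⟩)
    hrange₁ hrange₂
  -- `Ψ₂` is defined on `L₁ᵃᵇ ⊗ L₂ᵃᵇ ⊗ L₂ᵃᵇ`; the unsigned exchange of the first two factors is
  -- an even isomorphism onto the last summand.
  let c := TensorProduct.congr (TensorProduct.comm K (Ab K L₁) (Ab K L₂))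
    (LinearEquiv.refl K (Ab K L₂))
  have hc : IsEven c.toLinearMap := isEven_tensorComm.tensorMap isEven_id
  let e : P.multiplier 2 ≃ₗ[K] P₁.multiplier 2 × P₂.multiplier 2 ×
      AbelianLie ((Ab K L₂ ⊗[K] Ab K L₁) ⊗[K] Ab K L₁) ×
        AbelianLie ((Ab K L₂ ⊗[K] Ab K L₁) ⊗[K] Ab K L₂) := (LinearEquiv.ofBijective _ bij).trans ((LinearEquiv.refl K _).prodCongr
    ((LinearEquiv.refl K _).prodCongr ((LinearEquiv.refl K _).prodCongr c)))
  refine ⟨{ toLinearEquiv := e, map_part := fun i m hm => ?_, map_br := fun m m' => ?_ }⟩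
  · obtain ⟨a, ha, hi, rfl⟩ := P.exists_cls_of_mem_part hm
    exact ⟨hf₁ i _ hm, hf₂ i _ hm, hΘ₁ i a hi, hc i _ (hΘ₂ i a hi)⟩
  · change e (br K m m') = br K (e m) (e m')
    rw [multiplier_br, map_zero]
    exact Prod.ext (P₁.multiplier_br _ _).symm (Prod.ext (P₂.multiplier_br _ _).symm rfl)
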